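/- Let $D\subseteq\mathbb R^3$ be open, let $f\in C^\infty(D)$, and consider the second-order ODE $$y''=f(x,y,y'),\qquad (x,y,y')\in D. \tag{1}$$ Let $(x_0,y_0)$ be a point such that $(x_0,y_0,p)\in D$ for some $p$. For an open $U\subseteq\mathbb R^2$ write $D_U=\{(x,y,p)\in D:(x,y)\in U\}$. *Definitions.* The ODE (1) is linearizable by a point transformation near $(x_0,y_0)$ if there are an open neighbourhood $U$ of $(x_0,y_0)$ and smooth functions $t=\phi(x,y)$, $u=\psi(x,y)$ on $U$ with $J=\phi_x\psi_y-\phi_y\psi_x\ne 0$ on $U$ whose second prolongation transforms (1) over $U$ (at the jets with $\phi_x+\phi_y y'\neq 0$) into a linear equation $u_{tt}=a(t)u_t+b(t)u+c(t)$ with smooth coefficients. For a vector field $v=\xi(x,y)\partial_x+\eta(x,y)\partial_y$ on $U$ and a smooth function $\lambda(x,y,p)$ on $D_U$, put $\eta^{(1)}=D_x\eta-pD_x\xi+\lambda(\eta-\xi p)$ and $\eta^{(2)}=D_x\eta^{(1)}-qD_x\xi+\lambda(\eta^{(1)}-\xi q)$, where $p=y'$, $q=y''$ and $D_x$ is the total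 derivative. The pair $(v,\lambda)$ is a $\lambda$-symmetry of (1) over $U$ if $\eta^{(2)}=\xi f_x+\eta f_y+\eta^{(1)}f_p$ on $D_U$ when $q=f$. Two pairs $(v,\lambda)$, $(v',\lambda')$ are equivalent over $U$ if at each point of $D_U$ the vectors $\xi\partial_x+\eta\partial_y+\eta^{(1)}\partial_p$ and $\xi'\partial_x+\eta'\partial_y+\eta'^{(1)}\partial_p$ span, each together with $A=\partial_x+p\,\partial_y+f\,\partial_p$, the same subspace. *Statement.* (i) The ODE (1) is linearizable by a point transformation near $(x_0,y_0)$ if and only if there are an open neighbourhood $U$ of $(x_0,y_0)$ and smooth functions $F_3,F_2,F_1,F,w,z$ of $(x,y)$ on $U$ such that, over $U$, (a) (1) has the form $y''+F_3y'^3+F_2y'^2+F_1y'+F=0$; (b) (1) admits a $\lambda$-symmetry equivalent to the canonical pair $(\partial_y,\lambda_1)$, where $\lambda_1=-F_3y'^2-(F_2-w)y'-z$; (c) $w_x+z_y=\frac13\left(\frac{\partial F_2}{\partial x}+\frac{\partial F_1}{\partial y}\right)$. (ii) Whenever $U,F_3,F_2,F_1,F,w,z$ are as in (i), with (a), (b),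 (c), the system $$S_{yy}+(2w-F_2)S_y+F_3S_x=0,\quad S_{xy}+wS_x-zS_y=0,\quad S_{xx}+(F_1-2z)S_x-FS_y=0$$ has two functionally independent smooth solutions $\phi,\psi$ (that is, $\phi_x\psi_y-\phi_y\psi_x\ne0$ everywhere; in particular they are non-constant) on some open neighbourhood $V\subseteq U$ of $(x_0,y_0)$. Moreover, any two smooth solutions $\phi,\psi$ of this system on an open $V\subseteq U$ with $\phi_x\psi_y-\phi_y\psi_x\neq0$ on $V$ give a point transformation $t=\phi(x,y)$, $u=\psi(x,y)$ that transforms (1) over $V$ into the free particle equation $u_{tt}=0$. -/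

import Mathlib

open scoped ContDiff

namespace PointLin

/-! ### Partial derivatives and total derivatives

A point of the plane is `(x, y)`; a point of the first jet space is `(x, y, p)`, where `p` stands
for `y'`; the coordinate of the second jet space above it, standing for `y''`, is called `q`. -/

/-- `∂g/∂x` for a function of `(x, y)`. -/
noncomputable def dx (g : ℝ × ℝ → ℝ) (m : ℝ × ℝ) : ℝ := deriv (fun s => g (s, m.2)) m.1

/-- `∂g/∂y` for a function of `(x, y)`. -/
noncomputable def dy (g : ℝ × ℝ → ℝ) (m : ℝ × ℝ) : ℝ := deriv (fun s => g (m.1, s)) m.2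

/-- The point `(x, y)` below the jet `(x, y, p)`. -/
def base (j : ℝ × ℝ × ℝ) : ℝ × ℝ := (j.1, j.2.1)

/-- `∂G/∂x` for a function of `(x, y, p)`. -/
noncomputable def jx (G : ℝ × ℝ × ℝ → ℝ) (j : ℝ × ℝ × ℝ) : ℝ :=
  deriv (fun s => G (s, j.2.1, j.2.2)) j.1

/-- `∂G/∂y` for a function of `(x, y, p)`. -/
noncomputable def jy (G : ℝ × ℝ × ℝ → ℝ) (j : ℝ × ℝ × ℝ) : ℝ :=
  deriv (fun s => G (j.1, s, j.2.2)) j.2.1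

/-- `∂G/∂p` for a function of `(x, y, p)`. -/
noncomputable def jp (G : ℝ × ℝ × ℝ → ℝ) (j : ℝ × ℝ × ℝ) : ℝ :=
  deriv (fun s => G (j.1, j.2.1, s)) j.2.2

/-- Total derivative `D_x g = g_x + p g_y` of a function of `(x, y)`, at the jet `(x, y, p)`. -/
noncomputable def total (g : ℝ × ℝ → ℝ) (j : ℝ × ℝ × ℝ) : ℝ :=
  dx g (base j) + j.2.2 * dy g (base j)

/-- Total derivative `D_x G = G_x + p G_y + q G_p` of a function of `(x, y, p)`, at the second
order jet `(x, y, p, q)`. -/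
noncomputable def total₁ (G : ℝ × ℝ × ℝ → ℝ) (j : ℝ × ℝ × ℝ) (q : ℝ) : ℝ :=
  jx G j + j.2.2 * jy G j + q * jp G j

/-! ### Point transformations -/

/-- The Jacobian `J = φ_x ψ_y - φ_y ψ_x` of `t = φ(x, y)`, `u = ψ(x, y)`. -/
noncomputable def jacobian (φ ψ : ℝ × ℝ → ℝ) (m : ℝ × ℝ) : ℝ :=
  dx φ m * dy ψ m - dy φ m * dx ψ m

/-- `(φ, ψ)` is a smooth point transformation on `U`: its Jacobian vanishes nowhere on `U`. -/
structure IsPointTransformation (U : Set (ℝ × ℝ)) (φ ψ : ℝ × ℝ → ℝ) : Prop where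
  smooth_fst : ContDiffOn ℝ ∞ φ U
  smooth_snd : ContDiffOn ℝ ∞ ψ U
  jacobian_ne : ∀ m ∈ U, jacobian φ ψ m ≠ 0

/-- The transformed first derivative `du/dt = D_x ψ / D_x φ`. -/
noncomputable def newDeriv (φ ψ : ℝ × ℝ → ℝ) (j : ℝ × ℝ × ℝ) : ℝ := total ψ j / total φ j

/-- The transformed second derivative `d²u/dt² = D_x (du/dt) / D_x φ`. -/
noncomputable def newDeriv₂ (φ ψ : ℝ × ℝ → ℝ) (j : ℝ × ℝ × ℝ) (q : ℝ) : ℝ :=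
  total₁ (newDeriv φ ψ) j q / total φ j

/-- Over `U`, the change of variables `t = φ(x, y)`, `u = ψ(x, y)` turns the equation
`y'' = f(x, y, y')`, `(x, y, y') ∈ D`, into the linear equation
`d²u/dt² = a(t) du/dt + b(t) u + c(t)`: the second prolongation of the transformation identifies
the two equations at all jets at which it is defined, that is, where `D_x φ ≠ 0`. -/
def TransformsTo (D : Set (ℝ × ℝ × ℝ)) (f : ℝ × ℝ × ℝ → ℝ) (U : Set (ℝ × ℝ))
    (φ ψ : ℝ × ℝ → ℝ) (a b c : ℝ → ℝ) : Prop :=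
  ∀ j ∈ D, base j ∈ U → total φ j ≠ 0 → ∀ q : ℝ,
    q = f j ↔
      newDeriv₂ φ ψ j q =
        a (φ (base j)) * newDeriv φ ψ j + b (φ (base j)) * ψ (base j) + c (φ (base j))

/-- Near the point `m`, the equation `y'' = f(x, y, y')`, `(x, y, y') ∈ D`, can be mapped by a
point transformation to some linear second order equation with smooth coefficients. -/
def LinearizableAt (D : Set (ℝ × ℝ × ℝ)) (f : ℝ × ℝ × ℝ → ℝ) (m : ℝ × ℝ) : Prop :=
  ∃ (U : Set (ℝ × ℝ)) (φ ψ : ℝ × ℝ → ℝ) (T : Set ℝ) (a b c : ℝ → ℝ),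
    IsOpen U ∧ m ∈ U ∧ IsPointTransformation U φ ψ ∧
    IsOpen T ∧ Set.MapsTo φ U T ∧
    ContDiffOn ℝ ∞ a T ∧ ContDiffOn ℝ ∞ b T ∧ ContDiffOn ℝ ∞ c T ∧
    TransformsTo D f U φ ψ a b c

/-! ### `λ`-symmetries -/

/-- First `λ`-prolongation coefficient of `ξ ∂_x + η ∂_y`:
`η⁽¹⁾ = D_x η - p D_x ξ + λ (η - ξ p)`. -/
noncomputable def prolong₁ (ξ η : ℝ × ℝ → ℝ) (l : ℝ × ℝ × ℝ → ℝ) (j : ℝ × ℝ × ℝ) : ℝ :=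
  total η j - j.2.2 * total ξ j + l j * (η (base j) - ξ (base j) * j.2.2)

/-- Second `λ`-prolongation coefficient of `ξ ∂_x + η ∂_y`:
`η⁽²⁾ = D_x η⁽¹⁾ - q D_x ξ + λ (η⁽¹⁾ - ξ q)`. -/
noncomputable def prolong₂ (ξ η : ℝ × ℝ → ℝ) (l : ℝ × ℝ × ℝ → ℝ) (j : ℝ × ℝ × ℝ) (q : ℝ) : ℝ :=
  total₁ (prolong₁ ξ η l) j q - q * total ξ j + l j * (prolong₁ ξ η l j - ξ (base j) * q)

/-- `(ξ ∂_x + η ∂_y, λ)` is a `λ`-symmetry, over `U`, of `y'' = f(x, y, y')`, `(x, y, y') ∈ D`: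
the second `λ`-prolongation annihilates `q - f(x, y, p)` wherever `q = f(x, y, p)`. -/
structure IsLambdaSymmetry (D : Set (ℝ × ℝ × ℝ)) (f : ℝ × ℝ × ℝ → ℝ) (U : Set (ℝ × ℝ))
    (ξ η : ℝ × ℝ → ℝ) (l : ℝ × ℝ × ℝ → ℝ) : Prop where
  smooth_fst : ContDiffOn ℝ ∞ ξ U
  smooth_snd : ContDiffOn ℝ ∞ η U
  smooth_lambda : ContDiffOn ℝ ∞ l (D ∩ base ⁻¹' U)
  invariant : ∀ j ∈ D, base j ∈ U → ∀ q : ℝ, q = f j →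
    prolong₂ ξ η l j q -
      (ξ (base j) * jx f j + η (base j) * jy f j + prolong₁ ξ η l j * jp f j) = 0

/-- The first `λ`-prolongation `ξ ∂_x + η ∂_y + η⁽¹⁾ ∂_p` as a vector at the jet `j`. -/
noncomputable def prolongVec (ξ η : ℝ × ℝ → ℝ) (l : ℝ × ℝ × ℝ → ℝ) (j : ℝ × ℝ × ℝ) : ℝ × ℝ × ℝ :=
  (ξ (base j), η (base j), prolong₁ ξ η l j)

/-- The vector field `A = ∂_x + p ∂_y + f ∂_p` of the equation, as a vector at the jet `j`. -/
def odeVec (f : ℝ × ℝ × ℝ → ℝ) (j : ℝ × ℝ × ℝ) : ℝ × ℝ × ℝ := (1, j.2.2, f j)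

/-- Equivalence of the pairs `(ξ ∂_x + η ∂_y, λ)` and `(ξ' ∂_x + η' ∂_y, λ')` for the equation
`y'' = f(x, y, y')` over `U`: together with the vector field `A` of the equation, their first
prolongations span the same distribution. -/
def PairEquiv (D : Set (ℝ × ℝ × ℝ)) (f : ℝ × ℝ × ℝ → ℝ) (U : Set (ℝ × ℝ))
    (ξ η : ℝ × ℝ → ℝ) (l : ℝ × ℝ × ℝ → ℝ) (ξ' η' : ℝ × ℝ → ℝ) (l' : ℝ × ℝ × ℝ → ℝ) : Prop :=
  ∀ j ∈ D, base j ∈ U →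
    Submodule.span ℝ {odeVec f j, prolongVec ξ η l j} =
      Submodule.span ℝ {odeVec f j, prolongVec ξ' η' l' j}

/-! ### The criterion -/

/-- `λ₁ = -F₃ p² - (F₂ - w) p - z`. -/
def lambda₁ (F₃ F₂ w z : ℝ × ℝ → ℝ) (j : ℝ × ℝ × ℝ) : ℝ :=
  -F₃ (base j) * j.2.2 ^ 2 - (F₂ (base j) - w (base j)) * j.2.2 - z (base j)

/-- Over `U`, the equation `y'' = f(x, y, y')`, `(x, y, y') ∈ D`, is
`y'' + F₃ y'³ + F₂ y'² + F₁ y' + F = 0`, it admits a `λ`-symmetry equivalent to the canonical pair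
`(∂_y, λ₁)`, and `w_x + z_y = (1/3) (∂F₂/∂x + ∂F₁/∂y)`. -/
structure Criterion (D : Set (ℝ × ℝ × ℝ)) (f : ℝ × ℝ × ℝ → ℝ) (U : Set (ℝ × ℝ))
    (F₃ F₂ F₁ F w z : ℝ × ℝ → ℝ) : Prop where
  smooth_F₃ : ContDiffOn ℝ ∞ F₃ U
  smooth_F₂ : ContDiffOn ℝ ∞ F₂ U
  smooth_F₁ : ContDiffOn ℝ ∞ F₁ U
  smooth_F : ContDiffOn ℝ ∞ F U
  smooth_w : ContDiffOn ℝ ∞ w U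
  smooth_z : ContDiffOn ℝ ∞ z U
  cubic : ∀ j ∈ D, base j ∈ U →
    f j + F₃ (base j) * j.2.2 ^ 3 + F₂ (base j) * j.2.2 ^ 2 + F₁ (base j) * j.2.2
      + F (base j) = 0
  symmetry : ∃ (ξ η : ℝ × ℝ → ℝ) (l : ℝ × ℝ × ℝ → ℝ),
    IsLambdaSymmetry D f U ξ η l ∧
      PairEquiv D f U ξ η l (fun _ => 0) (fun _ => 1) (lambda₁ F₃ F₂ w z)
  auxiliary : ∀ m ∈ U, dx w m + dy z m = (1 / 3) * (dx F₂ m + dy F₁ m)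

/-- `S` is a smooth solution on `V` of the system
`S_yy + (2w - F₂) S_y + F₃ S_x = 0`, `S_xy + w S_x - z S_y = 0`,
`S_xx + (F₁ - 2z) S_x - F S_y = 0`. -/
structure SolvesSystem (V : Set (ℝ × ℝ)) (F₃ F₂ F₁ F w z S : ℝ × ℝ → ℝ) : Prop where
  smooth : ContDiffOn ℝ ∞ S V
  eq_yy : ∀ m ∈ V, dy (dy S) m + (2 * w m - F₂ m) * dy S m + F₃ m * dx S m = 0
  eq_xy : ∀ m ∈ V, dy (dx S) m + w m * dx S m - z m * dy S m = 0
  eq_xx : ∀ m ∈ V, dx (dx S) m + (F₁ m - 2 * z m) * dx S m - F m * dy S m = 0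

end PointLin

/-! Solved for its second derivatives, the system says that `S` is affine for a torsion-free
connection on the plane. Its unparametrized geodesics are the solution curves of the cubic equation,
and `w`, `z` are the freedom in choosing such a connection. Two independent affine functions are
flat coordinates: geodesics become straight lines, that is, u_tt = 0. So linearizability amounts to
flatness for a suitable choice of `w`, `z`.

For Y = (S, S_x, S_y) the system is a total differential equation dY = A Y, and its curvature
vanishes exactly under the four scalar equations of `IsFlatAt`. Three of them are the coefficients
in p of the determining equation A(λ₁) + λ₁² = f_y + λ₁ f_p, to which every λ-symmetry equivalent to
(∂_y, λ₁) reduces; the fourth is condition (c). This is the content of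
`IsLambdaSymmetry.determining`, `determining_defect`, `Criterion.isFlatAt` and `Criterion.of_flat`.
Solutions with prescribed gradient then come from the Frobenius theorem `exists_solution_of_flat`.

For the converse, let ζ solve ζ' = ζ² + aζ - b. On the (t, u)-plane the connection ∇dt = -(a + 2ζ)
dt², ∇du = -2ζ dt du + (bu + c) dt² is flat and has u_tt = a u_t + b u + c as geodesic equation. Its
pull-back by (φ, ψ) yields all six coefficient functions; see `isFlatAt_of_solvesInhomogeneous` and
`LinearizableAt.exists_criterion`. -/

open Set Metric
open scoped Topology

/-! ### A linear Frobenius theorem -/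

section Frobenius

variable {E F : Type*} [NormedAddCommGroup E] [NormedSpace ℝ E]
  [NormedAddCommGroup F] [NormedSpace ℝ F]

/-- A linear differential equation with small coefficients is solvable on the unit interval. -/
theorem exists_linear_ode_solution [CompleteSpace F] (B : ℝ → F →L[ℝ] F)
    (hB : ContinuousOn B (Icc 0 1)) (hB' : ∀ t ∈ Icc (0 : ℝ) 1, ‖B t‖ ≤ 1 / 2) (Y₀ : F) :
    ∃ y : ℝ → F, y 0 = Y₀ ∧
      (∀ t ∈ Icc (0 : ℝ) 1, HasDerivWithinAt y (B t (y t)) (Icc 0 1) t) ∧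
      ∀ t ∈ Icc (0 : ℝ) 1, ‖y t‖ ≤ 2 * ‖Y₀‖ := by
  -- On the ball of radius ‖Y₀‖ + 1 about Y₀ the speed is at most (2‖Y₀‖ + 1) / 2 ≤ ‖Y₀‖ + 1, so the
  -- solution cannot leave it in unit time.
  have hPL : IsPicardLindelof (fun t x => B t x) (⟨0, by simp⟩ : Icc (0 : ℝ) 1) Y₀
      (‖Y₀‖₊ + 1) 0 (‖Y₀‖₊ + 1) (1 / 2) := by
    refine ⟨fun t ht => ?_, fun x _ => hB.clm_apply continuousOn_const, fun t ht x hx => ?_, ?_⟩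
    · refine ((B t).lipschitz.weaken ?_).lipschitzOnWith
      exact_mod_cast hB' t ht
    · have h1 : ‖x‖ ≤ ‖Y₀‖ + (‖Y₀‖ + 1) := by
        have := norm_le_norm_add_norm_sub' x Y₀
        have h2 : ‖x - Y₀‖ ≤ ‖Y₀‖ + 1 := by simpa [dist_eq_norm] using hx
        linarith
      have h3 := (B t).le_opNorm x
      have h4 : ‖B t‖ * ‖x‖ ≤ 1 / 2 * (‖Y₀‖ + (‖Y₀‖ + 1)) :=
        mul_le_mul (hB' t ht) h1 (norm_nonneg _) (by norm_num)
      simp only [NNReal.coe_add, coe_nnnorm, NNReal.coe_one]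
      linarith
    · simp
  obtain ⟨y, hy0, hy⟩ := hPL.exists_eq_forall_mem_Icc_hasDerivWithinAt₀
  refine ⟨y, hy0, hy, fun t ht => ?_⟩
  have hg := norm_le_gronwallBound_of_norm_deriv_right_le (f := y) (f' := fun t => B t (y t))
    (δ := ‖Y₀‖) (K := 1 / 2) (ε := 0) (a := 0) (b := 1)
    (fun t ht => (hy t ht).continuousWithinAt)
    (fun t ht => (hy t ⟨ht.1, ht.2.le⟩).mono_of_mem_nhdsWithin (Icc_mem_nhdsGE_of_mem ht))
    (by rw [← hy0]) (fun t ht => by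
      have := (B t).le_opNorm (y t)
      have := mul_le_mul_of_nonneg_right (hB' t ⟨ht.1, ht.2.le⟩) (norm_nonneg (y t))
      linarith) t ht
  rw [gronwallBound_ε0] at hg
  -- The Grönwall factor is at most e^(1/2), and e ≤ 4.
  have h2 : Real.exp (1 / 2 * (t - 0)) ≤ 2 := by
    have h3 : Real.exp (1 / 2 * (t - 0)) ≤ Real.exp (1 / 2) :=
      Real.exp_le_exp.2 (by linarith [ht.2])
    have h4 : Real.exp (1 / 2) ^ 2 ≤ 2 ^ 2 := by
      rw [← Real.exp_nat_mul]; norm_num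
      linarith [Real.exp_one_lt_d9]
    have := (le_abs_self _).trans (abs_le_of_sq_le_sq h4 (by norm_num))
    linarith
  nlinarith [norm_nonneg Y₀]

/-- A `C²` map has, near a point, uniform bounds on its value and on the remainders of its first
two Taylor approximations. -/
theorem ContDiffAt.exists_taylor_bounds {G : Type*} [NormedAddCommGroup G] [NormedSpace ℝ G]
    {A : E → G} {m₀ : E} (hA : ContDiffAt ℝ 2 A m₀) :
    ∃ C > 0, ∃ r > 0, (∀ m ∈ ball m₀ r, ‖A m‖ ≤ C) ∧
      (∀ m ∈ ball m₀ r, ∀ m' ∈ ball m₀ r, ‖A m' - A m‖ ≤ C * ‖m' - m‖) ∧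
      ∀ m ∈ ball m₀ r, ∀ m' ∈ ball m₀ r,
        ‖A m' - A m - fderiv ℝ A m (m' - m)‖ ≤ C * ‖m' - m‖ ^ 2 := by
  obtain ⟨K, s, hs, hK⟩ := (hA.of_le (by norm_num : (1 : WithTop ℕ∞) ≤ 2)).exists_lipschitzOnWith
  have h1 : ContDiffAt ℝ 1 (fderiv ℝ A) m₀ := hA.fderiv_right (by norm_num)
  obtain ⟨K', s', hs', hK'⟩ := h1.exists_lipschitzOnWith
  have h2 : ∀ᶠ m in 𝓝 m₀, ‖A m‖ < ‖A m₀‖ + 1 :=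
    hA.continuousAt.norm.eventually_lt_const (by linarith)
  have h3 : ∀ᶠ m in 𝓝 m₀, DifferentiableAt ℝ A m :=
    (hA.eventually (by decide)).mono fun m hm => hm.differentiableAt (by norm_num)
  obtain ⟨r, hr, hr'⟩ := Metric.eventually_nhds_iff_ball.1
    (((Filter.eventually_mem_set.2 hs).and (Filter.eventually_mem_set.2 hs')).and (h2.and h3))
  refine ⟨‖A m₀‖ + 1 + K + K', by positivity, r, hr, fun m hm => ?_, fun m hm m' hm' => ?_,
    fun m hm m' hm' => ?_⟩
  · have := (hr' m hm).2.1
    have h4 : (0 : ℝ) ≤ K := K.2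
    have h5 : (0 : ℝ) ≤ K' := K'.2
    linarith
  · have := hK.norm_sub_le (hr' m' hm').1.1 (hr' m hm).1.1
    have h5 : (0 : ℝ) ≤ K' := K'.2
    refine this.trans (mul_le_mul_of_nonneg_right ?_ (norm_nonneg _))
    linarith [norm_nonneg (A m₀)]
  · have hseg : segment ℝ m m' ⊆ ball m₀ r := (convex_ball m₀ r).segment_subset hm hm'
    -- Mean value inequality for A minus its linearization at m; the Lipschitz bound on `fderiv ℝ A`
    -- supplies the second factor ‖m' - m‖.
    have := (convex_segment m m').norm_image_sub_le_of_norm_fderiv_le' (f := A)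
      (φ := fderiv ℝ A m) (C := K' * ‖m' - m‖) (x := m) (y := m') (𝕜 := ℝ)
      (fun x hx => (hr' x (hseg hx)).2.2) (fun x hx => by
        have h6 := hK'.norm_sub_le (hr' x (hseg hx)).1.2 (hr' m hm).1.2
        refine h6.trans (mul_le_mul_of_nonneg_left ?_ K'.2)
        exact norm_sub_le_of_mem_segment hx)
      (left_mem_segment ℝ m m') (right_mem_segment ℝ m m')
    refine this.trans ?_
    have h4 : (0 : ℝ) ≤ K := K.2
    rw [mul_assoc, ← pow_two]
    refine mul_le_mul_of_nonneg_right ?_ (by positivity)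
    linarith [norm_nonneg (A m₀)]

/-- Solutions of a total differential equation with smooth coefficients are smooth. -/
theorem contDiffOn_of_hasFDerivAt_linear {A : E → E →L[ℝ] F →L[ℝ] F} {V : Set E} {Y : E → F}
    (hV : IsOpen V) (hA : ContDiffOn ℝ ∞ A V)
    (hY : ∀ m ∈ V, HasFDerivAt Y ((A m).flip (Y m)) m) : ContDiffOn ℝ ∞ Y V := by
  have hd : DifferentiableOn ℝ Y V := fun m hm => (hY m hm).differentiableAt.differentiableWithinAt
  rw [contDiffOn_infty]
  intro n
  induction n with
  | zero => exact contDiffOn_zero.2 hd.continuousOn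
  | succ n ih =>
    push_cast
    rw [contDiffOn_succ_iff_fderiv_of_isOpen hV]
    refine ⟨hd, by simp, ?_⟩
    -- Bootstrap: the derivative of Y is bilinear in A and Y, hence as regular as Y itself.
    have h1 : ContDiffOn ℝ n (fun m => ContinuousLinearMap.apply ℝ F (Y m) ∘L A m) V := by
      refine ContDiffOn.clm_comp ?_ (contDiffOn_infty.1 hA n)
      exact ContDiff.comp_contDiffOn
        (ContinuousLinearMap.contDiff (𝕜 := ℝ) (ContinuousLinearMap.apply ℝ F (E := F))) ih
    exact h1.congr fun m hm => (hY m hm).fderiv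

/-- **Frobenius theorem** for the linear total differential equation `dY = A Y`: if `A` is flat on
`U`, there is a smooth local solution with any prescribed initial value. -/
theorem exists_solution_of_flat [CompleteSpace F] {A : E → E →L[ℝ] F →L[ℝ] F} {U : Set E}
    (hU : IsOpen U) (hA : ContDiffOn ℝ ∞ A U)
    (hflat : ∀ m ∈ U, ∀ (h k : E) (y : F),
      fderiv ℝ A m h k y + A m k (A m h y) = fderiv ℝ A m k h y + A m h (A m k y))
    {m₀ : E} (hm₀ : m₀ ∈ U) (Y₀ : F) :
    ∃ (V : Set E) (Y : E → F), IsOpen V ∧ m₀ ∈ V ∧ V ⊆ U ∧ Y m₀ = Y₀ ∧ ContDiffOn ℝ ∞ Y V ∧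
      ∀ m ∈ V, HasFDerivAt Y ((A m).flip (Y m)) m := by
  have hA₀ : ContDiffAt ℝ 2 A m₀ :=
    (contDiffOn_infty.1 hA 2).contDiffAt (hU.mem_nhds hm₀)
  obtain ⟨C, hC, r₁, hr₁, hb, hl, ht⟩ := hA₀.exists_taylor_bounds
  obtain ⟨r₂, hr₂, hr₂U⟩ := Metric.isOpen_iff.1 hU m₀ hm₀
  -- r ≤ 1 bounds the ray directions by 1, and C r ≤ 1/2 is the smallness required by
  -- `exists_linear_ode_solution`.
  obtain ⟨r, hr, hrr₁, hrr₂, hr1, hCr⟩ : ∃ r > 0, r ≤ r₁ ∧ r ≤ r₂ ∧ r ≤ 1 ∧ C * r ≤ 1 / 2 := by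
    refine ⟨min (min r₁ r₂) (min 1 (1 / (2 * C))), by positivity, by simp, by simp, by simp, ?_⟩
    calc C * _ ≤ C * (1 / (2 * C)) := by
          refine mul_le_mul_of_nonneg_left ?_ hC.le
          exact (min_le_right _ _).trans (min_le_right _ _)
      _ = 1 / 2 := by field_simp
  have hγ : ∀ m ∈ ball m₀ r, ∀ s ∈ Icc (0 : ℝ) 1, m₀ + s • (m - m₀) ∈ ball m₀ r := by
    intro m hm s hs
    have := (convex_ball m₀ r).add_smul_sub_mem (mem_ball_self hr) hm hs
    simpa using this
  have hmono : ∀ m ∈ ball m₀ r, m ∈ ball m₀ r₁ := fun m hm => ball_subset_ball hrr₁ hm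
  have hmonoU : ∀ m ∈ ball m₀ r, m ∈ U := fun m hm => hr₂U (ball_subset_ball hrr₂ hm)
  -- The solution is constructed by transport along each ray from m₀ to m; its value at time 1 will
  -- be Y(m).
  have hray : ∀ m ∈ ball m₀ r, ∃ y : ℝ → F, y 0 = Y₀ ∧
      (∀ t ∈ Icc (0 : ℝ) 1,
        HasDerivWithinAt y (A (m₀ + t • (m - m₀)) (m - m₀) (y t)) (Icc 0 1) t) ∧
      ∀ t ∈ Icc (0 : ℝ) 1, ‖y t‖ ≤ 2 * ‖Y₀‖ := by
    intro m hm
    refine exists_linear_ode_solution (fun t => A (m₀ + t • (m - m₀)) (m - m₀)) ?_ ?_ Y₀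
    · refine ContinuousOn.clm_apply (hA.continuousOn.comp (by fun_prop) fun t ht => ?_)
        continuousOn_const
      exact hmonoU _ (hγ m hm t ht)
    · intro t ht
      have h1 := (A (m₀ + t • (m - m₀))).le_opNorm (m - m₀)
      have h2 := hb _ (hmono _ (hγ m hm t ht))
      have h3 : ‖m - m₀‖ ≤ r := (mem_ball_iff_norm.1 hm).le
      calc _ ≤ _ := h1
        _ ≤ C * r := mul_le_mul h2 h3 (norm_nonneg _) hC.le
        _ ≤ 1 / 2 := hCr
  choose! y hy0 hy hyb using hray
  -- Differentiability of Y is obtained by comparing two rays directly, without smooth dependence on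
  -- parameters. The error y_{m'}(s) - y_m(s) - s A(m₀ + sv) h y_m(s) starts at 0 and satisfies a
  -- linear differential inequality with source O(‖h‖²), so it is O(‖h‖²) at s = 1.
  have hbound : ∀ m ∈ ball m₀ r, ∀ m' ∈ ball m₀ r,
      ‖y m' 1 - y m 1 - A m (m' - m) (y m 1)‖ ≤
        gronwallBound 0 (1 / 2) 1 1 * ((2 * C + (C + C) * C) * (2 * ‖Y₀‖)) * ‖m' - m‖ ^ 2 := by
    intro m hm m' hm'
    obtain ⟨v, hv⟩ : ∃ v, v = m - m₀ := ⟨_, rfl⟩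
    obtain ⟨h, hh⟩ : ∃ h, h = m' - m := ⟨_, rfl⟩
    have hv' : m' - m₀ = v + h := by rw [hv, hh]; abel
    have hvr : ‖v‖ ≤ 1 := by
      rw [hv]; exact (mem_ball_iff_norm.1 hm).le.trans hr1
    have hvr' : ‖v + h‖ ≤ 1 := by
      rw [← hv']; exact (mem_ball_iff_norm.1 hm').le.trans hr1
    have hvr'' : ‖v + h‖ ≤ r := by
      rw [← hv']; exact (mem_ball_iff_norm.1 hm').le
    have hg := hγ m hm
    have hg' := hγ m' hm'
    have hd := hy m hm
    have hd' := hy m' hm'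
    rw [← hh]
    simp only [hv', ← hv] at hg hg' hd hd'
    have hdiff : ∀ s ∈ Icc (0 : ℝ) 1, HasDerivWithinAt
        (fun s : ℝ => y m' s - y m s - s • A (m₀ + s • v) h (y m s))
        (A (m₀ + s • (v + h)) (v + h) (y m' s) - A (m₀ + s • v) v (y m s) -
          (s • (fderiv ℝ A (m₀ + s • v) v h (y m s) +
            A (m₀ + s • v) h (A (m₀ + s • v) v (y m s))) + A (m₀ + s • v) h (y m s)))
        (Icc 0 1) s := by
      intro s hs
      have hγd : HasDerivAt (fun s : ℝ => m₀ + s • v) v s := by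
        simpa using ((hasDerivAt_id s).smul_const v).const_add m₀
      have hAd : HasFDerivAt A (fderiv ℝ A (m₀ + s • v)) (m₀ + s • v) :=
        ((hA.contDiffAt (hU.mem_nhds (hmonoU _ (hg s hs)))).differentiableAt
          (by simp)).hasFDerivAt
      have hcomp : HasDerivAt (fun s : ℝ => A (m₀ + s • v)) (fderiv ℝ A (m₀ + s • v) v) s :=
        HasFDerivAt.comp_hasDerivAt (l := A) s hAd hγd
      have h1 : HasDerivWithinAt (fun s : ℝ => A (m₀ + s • v) h (y m s))
          (fderiv ℝ A (m₀ + s • v) v h (y m s) +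
            A (m₀ + s • v) h (A (m₀ + s • v) v (y m s))) (Icc 0 1) s := by
        have h2 := (hcomp.clm_apply (hasDerivAt_const s h)).hasDerivWithinAt (s := Icc 0 1)
        simpa using h2.clm_apply (hd s hs)
      refine ((hd' s hs).sub (hd s hs)).sub ?_
      have h3 : HasDerivWithinAt (fun s : ℝ => s) 1 (Icc 0 1) s := hasDerivWithinAt_id s _
      simpa using h3.fun_smul h1
    have hest : ∀ s ∈ Ico (0 : ℝ) 1,
        ‖A (m₀ + s • (v + h)) (v + h) (y m' s) - A (m₀ + s • v) v (y m s) -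
          (s • (fderiv ℝ A (m₀ + s • v) v h (y m s) +
            A (m₀ + s • v) h (A (m₀ + s • v) v (y m s))) + A (m₀ + s • v) h (y m s))‖ ≤
        1 / 2 * ‖y m' s - y m s - s • A (m₀ + s • v) h (y m s)‖ +
          (2 * C + (C + C) * C) * (2 * ‖Y₀‖) * ‖h‖ ^ 2 := by
      intro s hs
      have hs' : s ∈ Icc (0 : ℝ) 1 := ⟨hs.1, hs.2.le⟩
      have ha := hmono _ (hg s hs')
      have ha' := hmono _ (hg' s hs')
      have hyN := hyb m hm s hs'
      have hfl := hflat _ (hmonoU _ (hg s hs')) v h (y m s)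
      have hb1 := hb _ ha
      have hb2 := hb _ ha'
      have hl1 := hl _ ha _ ha'
      have ht1 := ht _ ha _ ha'
      have hsub : m₀ + s • (v + h) - (m₀ + s • v) = s • h := by
        rw [smul_add]; abel
      rw [hsub] at hl1 ht1
      generalize m₀ + s • (v + h) = a' at *
      generalize m₀ + s • v = a at *
      generalize y m s = Y at *
      generalize y m' s = Y' at *
      have hsh : ‖s • h‖ ≤ ‖h‖ := by
        rw [norm_smul, Real.norm_of_nonneg hs.1]
        exact mul_le_of_le_one_left (norm_nonneg _) hs.2.le
      -- Flatness exchanges v and h in the derivative term. What remains is A(a') (v + h) applied to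
      -- the error, plus terms of second order in h.
      have e : A a' (v + h) Y' - A a v Y -
          (s • (fderiv ℝ A a v h Y + A a h (A a v Y)) + A a h Y) =
          A a' (v + h) (Y' - Y - s • A a h Y) +
          (A a' - A a - fderiv ℝ A a (s • h)) v Y + (A a' - A a) h Y +
          s • ((A a' - A a) (v + h) (A a h Y) + A a h (A a h Y)) := by
        rw [hfl]
        simp only [map_sub, map_add, map_smul, sub_apply, add_apply, smul_apply,
          smul_add, smul_sub]
        abel
      rw [e]
      have n0 := norm_nonneg h
      have n1 : ‖A a' (v + h) (Y' - Y - s • A a h Y)‖ ≤ 1 / 2 * ‖Y' - Y - s • A a h Y‖ := by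
        refine ((A a' (v + h)).le_opNorm _).trans
          (mul_le_mul_of_nonneg_right ?_ (norm_nonneg _))
        refine ((A a').le_opNorm _).trans (le_trans ?_ hCr)
        exact mul_le_mul hb2 hvr'' (norm_nonneg _) hC.le
      have n2 : ‖(A a' - A a - fderiv ℝ A a (s • h)) v Y‖ ≤ C * ‖h‖ ^ 2 * (2 * ‖Y₀‖) := by
        refine ((_ : F →L[ℝ] F).le_opNorm _).trans
          (mul_le_mul ?_ hyN (norm_nonneg _) (by positivity))
        refine ((_ : E →L[ℝ] F →L[ℝ] F).le_opNorm _).trans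
          ((mul_le_of_le_one_right (norm_nonneg _) hvr).trans (ht1.trans ?_))
        gcongr
      have n3' : ‖A a' - A a‖ ≤ C * ‖h‖ := hl1.trans (by gcongr)
      have n3 : ‖(A a' - A a) h Y‖ ≤ C * ‖h‖ * ‖h‖ * (2 * ‖Y₀‖) := by
        refine ((_ : F →L[ℝ] F).le_opNorm _).trans
          (mul_le_mul ?_ hyN (norm_nonneg _) (by positivity))
        exact ((_ : E →L[ℝ] F →L[ℝ] F).le_opNorm _).trans (by gcongr)
      have n4 : ‖A a h Y‖ ≤ C * ‖h‖ * (2 * ‖Y₀‖) := by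
        refine ((_ : F →L[ℝ] F).le_opNorm _).trans
          (mul_le_mul ?_ hyN (norm_nonneg _) (by positivity))
        exact ((_ : E →L[ℝ] F →L[ℝ] F).le_opNorm _).trans (by gcongr)
      have n5 : ‖(A a' - A a) (v + h) (A a h Y)‖ ≤ C * ‖h‖ * (C * ‖h‖ * (2 * ‖Y₀‖)) := by
        refine ((_ : F →L[ℝ] F).le_opNorm _).trans
          (mul_le_mul ?_ n4 (norm_nonneg _) (by positivity))
        exact ((_ : E →L[ℝ] F →L[ℝ] F).le_opNorm _).trans
          ((mul_le_of_le_one_right (norm_nonneg _) hvr').trans n3')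
      have n6 : ‖A a h (A a h Y)‖ ≤ C * ‖h‖ * (C * ‖h‖ * (2 * ‖Y₀‖)) := by
        refine ((_ : F →L[ℝ] F).le_opNorm _).trans
          (mul_le_mul ?_ n4 (norm_nonneg _) (by positivity))
        exact ((_ : E →L[ℝ] F →L[ℝ] F).le_opNorm _).trans (by gcongr)
      have n7 : ‖s • ((A a' - A a) (v + h) (A a h Y) + A a h (A a h Y))‖ ≤
          C * ‖h‖ * (C * ‖h‖ * (2 * ‖Y₀‖)) + C * ‖h‖ * (C * ‖h‖ * (2 * ‖Y₀‖)) := by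
        rw [norm_smul, Real.norm_of_nonneg hs.1]
        exact (mul_le_of_le_one_left (norm_nonneg _) hs.2.le).trans
          ((norm_add_le _ _).trans (add_le_add n5 n6))
      refine (norm_add_le _ _).trans ((add_le_add ((norm_add_le _ _).trans
        (add_le_add ((norm_add_le _ _).trans (add_le_add n1 n2)) n3)) n7).trans (le_of_eq ?_))
      ring
    have := norm_le_gronwallBound_of_norm_deriv_right_le (a := 0) (b := 1) (δ := 0)
      (fun s hs => (hdiff s hs).continuousWithinAt)
      (fun s hs => (hdiff s ⟨hs.1, hs.2.le⟩).mono_of_mem_nhdsWithin (Icc_mem_nhdsGE_of_mem hs))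
      (by simp [hy0 m hm, hy0 m' hm']) hest 1 (right_mem_Icc.2 zero_le_one)
    have hm1 : m₀ + v = m := by rw [hv]; abel
    simp only [one_smul, hm1, sub_zero] at this
    refine this.trans (le_of_eq ?_)
    rw [gronwallBound_of_K_ne_0 (by norm_num), gronwallBound_of_K_ne_0 (by norm_num)]
    ring
  refine ⟨ball m₀ r, fun m => y m 1, isOpen_ball, mem_ball_self hr, fun m hm => hmonoU m hm, ?_,
    ?_⟩
  -- The ray to m₀ is constant, so transport along it is trivial.
  · have h0 := hy m₀ (mem_ball_self hr)
    have := (convex_Icc (0 : ℝ) 1).norm_image_sub_le_of_norm_hasDerivWithin_le (C := 0) h0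
      (fun t _ => by simp) (left_mem_Icc.2 zero_le_one) (right_mem_Icc.2 zero_le_one)
    rw [zero_mul, norm_le_zero_iff, sub_eq_zero, hy0 m₀ (mem_ball_self hr)] at this
    exact this
  have hder : ∀ m ∈ ball m₀ r, HasFDerivAt (fun m => y m 1) ((A m).flip (y m 1)) m := by
    intro m hm
    refine HasFDerivAt.of_isLittleO ?_
    have h1 : (fun m' => y m' 1 - y m 1 - (A m).flip (y m 1) (m' - m)) =O[𝓝 m]
        fun m' => ‖m' - m‖ ^ 2 := by
      refine Asymptotics.IsBigO.of_bound
        (gronwallBound 0 (1 / 2) 1 1 * ((2 * C + (C + C) * C) * (2 * ‖Y₀‖))) ?_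
      filter_upwards [isOpen_ball.mem_nhds hm] with m' hm'
      simpa using hbound m hm m' hm'
    refine h1.trans_isLittleO ?_
    have h2 : (fun m' => ‖m' - m‖ ^ 2) =o[𝓝 m] fun m' => m' - m := by
      have := (Asymptotics.isLittleO_norm_pow_id (E' := E) one_lt_two)
      refine this.comp_tendsto (k := fun m' => m' - m) ?_
      exact tendsto_sub_nhds_zero_iff.2 Filter.tendsto_id
    exact h2
  exact ⟨contDiffOn_of_hasFDerivAt_linear isOpen_ball (hA.mono hmonoU) hder, hder⟩

end Frobenius

namespace PointLin

/-! ### Calculus in the plane and in the jet space -/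

section Calculus

variable {V : Set (ℝ × ℝ)} {g : ℝ × ℝ → ℝ} {m : ℝ × ℝ}

theorem hasDerivAt_slice_fst {L : ℝ × ℝ →L[ℝ] ℝ} (h : HasFDerivAt g L m) :
    HasDerivAt (fun s => g (s, m.2)) (L (1, 0)) m.1 :=
  HasFDerivAt.comp_hasDerivAt (l := g) m.1 h
    ((hasDerivAt_id m.1).prodMk (hasDerivAt_const m.1 m.2))

theorem hasDerivAt_slice_snd {L : ℝ × ℝ →L[ℝ] ℝ} (h : HasFDerivAt g L m) :
    HasDerivAt (fun s => g (m.1, s)) (L (0, 1)) m.2 :=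
  HasFDerivAt.comp_hasDerivAt (l := g) m.2 h
    ((hasDerivAt_const m.2 m.1).prodMk (hasDerivAt_id m.2))

theorem dx_eq_of_hasFDerivAt {L : ℝ × ℝ →L[ℝ] ℝ} (h : HasFDerivAt g L m) : dx g m = L (1, 0) :=
  (hasDerivAt_slice_fst h).deriv

theorem dy_eq_of_hasFDerivAt {L : ℝ × ℝ →L[ℝ] ℝ} (h : HasFDerivAt g L m) : dy g m = L (0, 1) :=
  (hasDerivAt_slice_snd h).deriv

theorem apply_eq_of_hasFDerivAt {L : ℝ × ℝ →L[ℝ] ℝ} (h : HasFDerivAt g L m) (k : ℝ × ℝ) :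
    L k = k.1 * dx g m + k.2 * dy g m := by
  rw [dx_eq_of_hasFDerivAt h, dy_eq_of_hasFDerivAt h]
  calc L k = L (k.1 • (1, 0) + k.2 • (0, 1)) := by simp
    _ = _ := by rw [map_add, map_smul, map_smul, smul_eq_mul, smul_eq_mul]

theorem differentiableAt_of_smooth (hV : IsOpen V) (hg : ContDiffOn ℝ ∞ g V) (hm : m ∈ V) :
    DifferentiableAt ℝ g m :=
  (hg.contDiffAt (hV.mem_nhds hm)).differentiableAt (by simp)

theorem hasDerivAt_dx (hV : IsOpen V) (hg : ContDiffOn ℝ ∞ g V) (hm : m ∈ V) :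
    HasDerivAt (fun s => g (s, m.2)) (dx g m) m.1 :=
  (hasDerivAt_slice_fst (differentiableAt_of_smooth hV hg hm).hasFDerivAt).differentiableAt.hasDerivAt

theorem hasDerivAt_dy (hV : IsOpen V) (hg : ContDiffOn ℝ ∞ g V) (hm : m ∈ V) :
    HasDerivAt (fun s => g (m.1, s)) (dy g m) m.2 :=
  (hasDerivAt_slice_snd (differentiableAt_of_smooth hV hg hm).hasFDerivAt).differentiableAt.hasDerivAt

theorem dx_eq_fderiv (hV : IsOpen V) (hg : ContDiffOn ℝ ∞ g V) (hm : m ∈ V) :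
    dx g m = fderiv ℝ g m (1, 0) :=
  dx_eq_of_hasFDerivAt (differentiableAt_of_smooth hV hg hm).hasFDerivAt

theorem dy_eq_fderiv (hV : IsOpen V) (hg : ContDiffOn ℝ ∞ g V) (hm : m ∈ V) :
    dy g m = fderiv ℝ g m (0, 1) :=
  dy_eq_of_hasFDerivAt (differentiableAt_of_smooth hV hg hm).hasFDerivAt

theorem smooth_dx (hV : IsOpen V) (hg : ContDiffOn ℝ ∞ g V) : ContDiffOn ℝ ∞ (dx g) V :=
  ((hg.fderiv_of_isOpen hV le_rfl).clm_apply contDiffOn_const).congr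
    fun _ hm => dx_eq_fderiv hV hg hm

theorem smooth_dy (hV : IsOpen V) (hg : ContDiffOn ℝ ∞ g V) : ContDiffOn ℝ ∞ (dy g) V :=
  ((hg.fderiv_of_isOpen hV le_rfl).clm_apply contDiffOn_const).congr
    fun _ hm => dy_eq_fderiv hV hg hm

theorem eventually_slice_fst (hV : IsOpen V) (hm : m ∈ V) : ∀ᶠ s in 𝓝 m.1, (s, m.2) ∈ V :=
  (show Continuous fun s : ℝ => (s, m.2) by fun_prop).continuousAt.eventually_mem
    (hV.mem_nhds hm)

theorem eventually_slice_snd (hV : IsOpen V) (hm : m ∈ V) : ∀ᶠ s in 𝓝 m.2, (m.1, s) ∈ V :=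
  (show Continuous fun s : ℝ => (m.1, s) by fun_prop).continuousAt.eventually_mem
    (hV.mem_nhds hm)

theorem dx_congr {h : ℝ × ℝ → ℝ} (hV : IsOpen V) (hm : m ∈ V) (hgh : EqOn g h V) :
    dx g m = dx h m :=
  Filter.EventuallyEq.deriv_eq ((eventually_slice_fst hV hm).mono fun _ hs => hgh hs)

theorem dy_congr {h : ℝ × ℝ → ℝ} (hV : IsOpen V) (hm : m ∈ V) (hgh : EqOn g h V) :
    dy g m = dy h m :=
  Filter.EventuallyEq.deriv_eq ((eventually_slice_snd hV hm).mono fun _ hs => hgh hs)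

/-- Second partial derivatives of a smooth function commute. -/
theorem dx_dy_comm (hV : IsOpen V) (hg : ContDiffOn ℝ ∞ g V) (hm : m ∈ V) :
    dx (dy g) m = dy (dx g) m := by
  have h2 := (hg.fderiv_of_isOpen hV (m := ∞) le_rfl).contDiffAt (hV.mem_nhds hm)
  have h3 := (h2.differentiableAt (by simp)).hasFDerivAt
  have hx : HasFDerivAt (fun m => fderiv ℝ g m (1, 0)) _ m :=
    h3.clm_apply (hasFDerivAt_const _ m)
  have hy : HasFDerivAt (fun m => fderiv ℝ g m (0, 1)) _ m :=
    h3.clm_apply (hasFDerivAt_const _ m)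
  rw [dx_congr hV hm fun _ hm => dy_eq_fderiv hV hg hm,
    dy_congr hV hm fun _ hm => dx_eq_fderiv hV hg hm, dx_eq_of_hasFDerivAt hy,
    dy_eq_of_hasFDerivAt hx]
  have hs := ((contDiffOn_infty.1 hg 2).contDiffAt (hV.mem_nhds hm)).isSymmSndFDerivAt (by simp)
  simpa using hs (1, 0) (0, 1)

variable {W : Set (ℝ × ℝ × ℝ)} {G H : ℝ × ℝ × ℝ → ℝ} {j : ℝ × ℝ × ℝ}

theorem jx_congr (hW : IsOpen W) (hj : j ∈ W) (h : EqOn G H W) : jx G j = jx H j := by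
  have : ∀ᶠ s in 𝓝 j.1, (s, j.2.1, j.2.2) ∈ W :=
    (show Continuous fun s : ℝ => (s, j.2.1, j.2.2) by fun_prop).continuousAt.eventually_mem
      (hW.mem_nhds hj)
  exact Filter.EventuallyEq.deriv_eq (this.mono fun _ hs => h hs)

theorem jy_congr (hW : IsOpen W) (hj : j ∈ W) (h : EqOn G H W) : jy G j = jy H j := by
  have : ∀ᶠ s in 𝓝 j.2.1, (j.1, s, j.2.2) ∈ W :=
    (show Continuous fun s : ℝ => (j.1, s, j.2.2) by fun_prop).continuousAt.eventually_mem
      (hW.mem_nhds hj)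
  exact Filter.EventuallyEq.deriv_eq (this.mono fun _ hs => h hs)

theorem eventually_fiber (hW : IsOpen W) (hj : j ∈ W) : ∀ᶠ s in 𝓝 j.2.2, (j.1, j.2.1, s) ∈ W :=
  (show Continuous fun s : ℝ => (j.1, j.2.1, s) by fun_prop).continuousAt.eventually_mem
    (hW.mem_nhds hj)

theorem jp_congr (hW : IsOpen W) (hj : j ∈ W) (h : EqOn G H W) : jp G j = jp H j :=
  Filter.EventuallyEq.deriv_eq ((eventually_fiber hW hj).mono fun _ hs => h hs)

theorem hasDerivAt_jx (hW : IsOpen W) (hG : ContDiffOn ℝ ∞ G W) (hj : j ∈ W) :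
    HasDerivAt (fun s => G (s, j.2.1, j.2.2)) (jx G j) j.1 := by
  have h : DifferentiableAt ℝ G (j.1, j.2.1, j.2.2) :=
    (hG.contDiffAt (hW.mem_nhds hj)).differentiableAt (by simp)
  exact (DifferentiableAt.comp j.1 (f := fun s => (s, j.2.1, j.2.2)) h
    (by fun_prop)).hasDerivAt

theorem hasDerivAt_jy (hW : IsOpen W) (hG : ContDiffOn ℝ ∞ G W) (hj : j ∈ W) :
    HasDerivAt (fun s => G (j.1, s, j.2.2)) (jy G j) j.2.1 := by
  have h : DifferentiableAt ℝ G (j.1, j.2.1, j.2.2) :=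
    (hG.contDiffAt (hW.mem_nhds hj)).differentiableAt (by simp)
  exact (DifferentiableAt.comp j.2.1 (f := fun s => (j.1, s, j.2.2)) h
    (by fun_prop)).hasDerivAt

theorem hasDerivAt_jp (hW : IsOpen W) (hG : ContDiffOn ℝ ∞ G W) (hj : j ∈ W) :
    HasDerivAt (fun s => G (j.1, j.2.1, s)) (jp G j) j.2.2 := by
  have h : DifferentiableAt ℝ G (j.1, j.2.1, j.2.2) :=
    (hG.contDiffAt (hW.mem_nhds hj)).differentiableAt (by simp)
  exact (DifferentiableAt.comp j.2.2 (f := fun s => (j.1, j.2.1, s)) h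
    (by fun_prop)).hasDerivAt

theorem continuous_base : Continuous base := by unfold base; fun_prop

theorem contDiff_base : ContDiff ℝ ∞ base := by unfold base; fun_prop

end Calculus

/-! ### The second prolongation of a point transformation -/

/-- Second total derivative `S_xx + 2 p S_xy + p² S_yy + q S_y`. -/
noncomputable def total₂ (S : ℝ × ℝ → ℝ) (j : ℝ × ℝ × ℝ) (q : ℝ) : ℝ :=
  dx (dx S) (base j) + 2 * j.2.2 * dy (dx S) (base j) + j.2.2 ^ 2 * dy (dy S) (base j) +
    q * dy S (base j)

section Prolongation

variable {V : Set (ℝ × ℝ)} {φ ψ : ℝ × ℝ → ℝ} {j : ℝ × ℝ × ℝ}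

theorem hasDerivAt_total_fst (hV : IsOpen V) (hφ : ContDiffOn ℝ ∞ φ V) (hj : base j ∈ V) :
    HasDerivAt (fun s => total φ (s, j.2.1, j.2.2))
      (dx (dx φ) (base j) + j.2.2 * dy (dx φ) (base j)) j.1 := by
  rw [← dx_dy_comm hV hφ hj]
  exact (hasDerivAt_dx hV (smooth_dx hV hφ) hj).add
    ((hasDerivAt_dx hV (smooth_dy hV hφ) hj).const_mul j.2.2)

theorem hasDerivAt_total_snd (hV : IsOpen V) (hφ : ContDiffOn ℝ ∞ φ V) (hj : base j ∈ V) :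
    HasDerivAt (fun s => total φ (j.1, s, j.2.2))
      (dy (dx φ) (base j) + j.2.2 * dy (dy φ) (base j)) j.2.1 :=
  (hasDerivAt_dy hV (smooth_dx hV hφ) hj).add
    ((hasDerivAt_dy hV (smooth_dy hV hφ) hj).const_mul j.2.2)

theorem hasDerivAt_total_fiber (φ : ℝ × ℝ → ℝ) (j : ℝ × ℝ × ℝ) :
    HasDerivAt (fun s => total φ (j.1, j.2.1, s)) (dy φ (base j)) j.2.2 := by
  simpa [total, base] using
    ((hasDerivAt_id j.2.2).mul_const (dy φ (base j))).const_add (dx φ (base j))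

/-- Quotient rule. In this form q enters the numerator with coefficient D_xφ ψ_y - D_xψ φ_y = J, so
the transformed equation can be solved for q. -/
theorem newDeriv₂_eq (hV : IsOpen V) (hφ : ContDiffOn ℝ ∞ φ V) (hψ : ContDiffOn ℝ ∞ ψ V)
    (hj : base j ∈ V) (h0 : total φ j ≠ 0) (q : ℝ) :
    newDeriv₂ φ ψ j q =
      (total φ j * total₂ ψ j q - total ψ j * total₂ φ j q) / total φ j ^ 3 := by
  have hx : jx (newDeriv φ ψ) j = _ :=
    ((hasDerivAt_total_fst hV hψ hj).div (hasDerivAt_total_fst hV hφ hj) h0).deriv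
  have hy : jy (newDeriv φ ψ) j = _ :=
    ((hasDerivAt_total_snd hV hψ hj).div (hasDerivAt_total_snd hV hφ hj) h0).deriv
  have hp : jp (newDeriv φ ψ) j = _ :=
    ((hasDerivAt_total_fiber ψ j).div (hasDerivAt_total_fiber φ j) h0).deriv
  unfold newDeriv₂ total₁
  rw [hx, hy, hp]
  have h0' : total φ (j.1, j.2.1, j.2.2) ≠ 0 := h0
  change (_ / total φ j ^ 2 + j.2.2 * (_ / total φ j ^ 2) + q * (_ / total φ j ^ 2)) / _ = _
  simp only [total₂, Prod.mk.eta]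
  field_simp
  ring

end Prolongation

/-! ### The determining equation of a canonical pair -/

section Determining

variable {D : Set (ℝ × ℝ × ℝ)} {f : ℝ × ℝ × ℝ → ℝ} {U : Set (ℝ × ℝ)}
  {F₃ F₂ F₁ F w z : ℝ × ℝ → ℝ}

theorem prolong₁_canonical (l : ℝ × ℝ × ℝ → ℝ) :
    prolong₁ (fun _ => 0) (fun _ => 1) l = l := by
  funext j
  simp [prolong₁, total, dx, dy]

theorem prolong₂_canonical (l : ℝ × ℝ × ℝ → ℝ) (j : ℝ × ℝ × ℝ) (q : ℝ) :
    prolong₂ (fun _ => 0) (fun _ => 1) l j q = total₁ l j q + l j ^ 2 := by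
  rw [prolong₂, prolong₁_canonical]
  simp [total, dx, dy, pow_two]

/-- A pair equivalent to `(∂_y, l)` has first prolongation `ξ A + (η - ξ p) (∂_y + l ∂_p)`, with
`η - ξ p ≠ 0`. -/
theorem PairEquiv.prolong₁_eq {ξ η : ℝ × ℝ → ℝ} {l l' : ℝ × ℝ × ℝ → ℝ}
    (h : PairEquiv D f U ξ η l (fun _ => 0) (fun _ => 1) l') {j : ℝ × ℝ × ℝ} (hj : j ∈ D)
    (hjU : base j ∈ U) :
    prolong₁ ξ η l j = ξ (base j) * f j + (η (base j) - ξ (base j) * j.2.2) * l' j ∧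
      η (base j) - ξ (base j) * j.2.2 ≠ 0 := by
  have hs := h j hj hjU
  have h1 : prolongVec ξ η l j ∈
      Submodule.span ℝ {odeVec f j, prolongVec (fun _ => 0) (fun _ => 1) l' j} := by
    rw [← hs]; exact Submodule.subset_span (by simp)
  have h2 : prolongVec (fun _ => 0) (fun _ => 1) l' j ∈
      Submodule.span ℝ {odeVec f j, prolongVec ξ η l j} := by
    rw [hs]; exact Submodule.subset_span (by simp)
  obtain ⟨a, b, hab⟩ := Submodule.mem_span_pair.1 h1
  obtain ⟨c, d, hcd⟩ := Submodule.mem_span_pair.1 h2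
  simp only [odeVec, prolongVec, prolong₁_canonical, Prod.smul_mk, Prod.mk_add_mk, smul_eq_mul,
    Prod.mk.injEq, mul_one, mul_zero, add_zero] at hab hcd
  obtain ⟨a1, a2, a3⟩ := hab
  obtain ⟨c1, c2, c3⟩ := hcd
  refine ⟨?_, fun h0 => ?_⟩
  · rw [← a3, ← a2, ← a1]; ring
  -- The functional (X, Y, P) ↦ Y - pX kills A, takes the value η - ξp on the first pair and 1 on
  -- the canonical one.
  · have : (0 : ℝ) = 1 := by linear_combination c2 - j.2.2 * c1 - d * h0
    exact zero_ne_one this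

/-- `A(l) + l² = f_y + l f_p` whenever the equation has a `λ`-symmetry equivalent to
`(∂_y, l)`. -/
theorem IsLambdaSymmetry.determining {ξ η : ℝ × ℝ → ℝ} {l l' : ℝ × ℝ × ℝ → ℝ} (hD : IsOpen D)
    (hf : ContDiffOn ℝ ∞ f D) (hU : IsOpen U) (hs : IsLambdaSymmetry D f U ξ η l)
    (he : PairEquiv D f U ξ η l (fun _ => 0) (fun _ => 1) l')
    (hl' : ContDiffOn ℝ ∞ l' (D ∩ base ⁻¹' U)) {j : ℝ × ℝ × ℝ} (hj : j ∈ D) (hjU : base j ∈ U) :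
    total₁ l' j (f j) + l' j ^ 2 = jy f j + l' j * jp f j := by
  have hW : IsOpen (D ∩ base ⁻¹' U) := hD.inter (hU.preimage continuous_base)
  have hjW : j ∈ D ∩ base ⁻¹' U := ⟨hj, hjU⟩
  have hEq : EqOn (prolong₁ ξ η l)
      (fun j => ξ (base j) * f j + (η (base j) - ξ (base j) * j.2.2) * l' j)
      (D ∩ base ⁻¹' U) := fun j hj => (he.prolong₁_eq hj.1 hj.2).1
  have hξx := hasDerivAt_dx hU hs.smooth_fst hjU
  have hξy := hasDerivAt_dy hU hs.smooth_fst hjU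
  have hηx := hasDerivAt_dx hU hs.smooth_snd hjU
  have hηy := hasDerivAt_dy hU hs.smooth_snd hjU
  have hfx := hasDerivAt_jx hD hf hj
  have hfy := hasDerivAt_jy hD hf hj
  have hfp := hasDerivAt_jp hD hf hj
  have hlx := hasDerivAt_jx hW hl' hjW
  have hly := hasDerivAt_jy hW hl' hjW
  have hlp := hasDerivAt_jp hW hl' hjW
  have hx : jx (prolong₁ ξ η l) j = dx ξ (base j) * f j + ξ (base j) * jx f j +
      ((dx η (base j) - dx ξ (base j) * j.2.2) * l' j +
        (η (base j) - ξ (base j) * j.2.2) * jx l' j) := by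
    rw [jx_congr hW hjW hEq]
    exact ((hξx.mul hfx).add ((hηx.sub (hξx.mul_const j.2.2)).mul hlx)).deriv
  have hy : jy (prolong₁ ξ η l) j = dy ξ (base j) * f j + ξ (base j) * jy f j +
      ((dy η (base j) - dy ξ (base j) * j.2.2) * l' j +
        (η (base j) - ξ (base j) * j.2.2) * jy l' j) := by
    rw [jy_congr hW hjW hEq]
    exact ((hξy.mul hfy).add ((hηy.sub (hξy.mul_const j.2.2)).mul hly)).deriv
  have hp : jp (prolong₁ ξ η l) j = ξ (base j) * jp f j +
      (-ξ (base j) * l' j + (η (base j) - ξ (base j) * j.2.2) * jp l' j) := by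
    rw [jp_congr hW hjW hEq]
    have h1 : HasDerivAt (fun s : ℝ => η (base j) - ξ (base j) * s) (-ξ (base j)) j.2.2 := by
      simpa using ((hasDerivAt_id j.2.2).const_mul (ξ (base j))).const_sub (η (base j))
    exact ((hfp.const_mul (ξ (base j))).add (h1.mul hlp)).deriv
  obtain ⟨h1, h0⟩ := he.prolong₁_eq hj hjU
  have hinv := hs.invariant j hj hjU (f j) rfl
  have hdef : prolong₁ ξ η l j = total η j - j.2.2 * total ξ j +
    l j * (η (base j) - ξ (base j) * j.2.2) := rfl
  rw [prolong₂, total₁, hx, hy, hp, h1] at hinv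
  rw [h1] at hdef
  simp only [total] at hinv hdef
  rw [total₁]
  -- The invariance condition is η - ξp times the determining equation of l'. The remaining terms in
  -- l occur only as l (η - ξp), which `hdef` eliminates.
  refine mul_left_cancel₀ h0 ?_
  linear_combination hinv + l' j * hdef

/-- The fibre of D over a point is only known to be open, so the coefficients are recovered from
values at p and p ± ε/2: the second difference gives a, the first difference b. -/
theorem quadratic_coeffs_eq_zero {a b c p : ℝ} (h : ∀ᶠ s in 𝓝 p, a * s ^ 2 + b * s + c = 0) :
    a = 0 ∧ b = 0 ∧ c = 0 := by
  obtain ⟨ε, hε, h⟩ := Metric.eventually_nhds_iff_ball.1 h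
  have h0 := h p (mem_ball_self hε)
  have h1 := h (p + ε / 2) (by rw [mem_ball_iff_norm]; simp [abs_of_pos hε, hε])
  have h2 := h (p - ε / 2) (by rw [mem_ball_iff_norm]; simp [abs_of_pos hε, hε])
  have ha : a = 0 := by
    have : a * ε ^ 2 = 0 := by linear_combination 2 * (h1 + h2 - 2 * h0)
    exact (mul_eq_zero.1 this).resolve_right (by positivity)
  subst ha
  have hb : b = 0 := by
    have : b * ε = 0 := by linear_combination h1 - h2
    exact (mul_eq_zero.1 this).resolve_right hε.ne'
  subst hb
  exact ⟨rfl, rfl, by linear_combination h0⟩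

theorem smooth_lambda₁ (hF₃ : ContDiffOn ℝ ∞ F₃ U) (hF₂ : ContDiffOn ℝ ∞ F₂ U)
    (hw : ContDiffOn ℝ ∞ w U) (hz : ContDiffOn ℝ ∞ z U) :
    ContDiffOn ℝ ∞ (lambda₁ F₃ F₂ w z) (D ∩ base ⁻¹' U) := by
  have hb : MapsTo base (D ∩ base ⁻¹' U) U := fun _ h => h.2
  have h3 := hF₃.comp contDiff_base.contDiffOn hb
  have h2 := hF₂.comp contDiff_base.contDiffOn hb
  have hw := hw.comp contDiff_base.contDiffOn hb
  have hz := hz.comp contDiff_base.contDiffOn hb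
  have hp : ContDiffOn ℝ ∞ (fun j : ℝ × ℝ × ℝ => j.2.2) (D ∩ base ⁻¹' U) := by fun_prop
  exact ((h3.neg.mul (hp.pow 2)).sub ((h2.sub hw).mul hp)).sub hz

theorem total₁_lambda₁ (hU : IsOpen U) (hF₃ : ContDiffOn ℝ ∞ F₃ U) (hF₂ : ContDiffOn ℝ ∞ F₂ U)
    (hw : ContDiffOn ℝ ∞ w U) (hz : ContDiffOn ℝ ∞ z U) {j : ℝ × ℝ × ℝ} (hj : base j ∈ U)
    (q : ℝ) :
    total₁ (lambda₁ F₃ F₂ w z) j q =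
      -total F₃ j * j.2.2 ^ 2 - (total F₂ j - total w j) * j.2.2 - total z j -
        q * (2 * F₃ (base j) * j.2.2 + (F₂ (base j) - w (base j))) := by
  have hx : jx (lambda₁ F₃ F₂ w z) j = _ :=
    ((((hasDerivAt_dx hU hF₃ hj).neg.mul_const (j.2.2 ^ 2)).sub
      (((hasDerivAt_dx hU hF₂ hj).sub (hasDerivAt_dx hU hw hj)).mul_const j.2.2)).sub
      (hasDerivAt_dx hU hz hj)).deriv
  have hy : jy (lambda₁ F₃ F₂ w z) j = _ :=
    ((((hasDerivAt_dy hU hF₃ hj).neg.mul_const (j.2.2 ^ 2)).sub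
      (((hasDerivAt_dy hU hF₂ hj).sub (hasDerivAt_dy hU hw hj)).mul_const j.2.2)).sub
      (hasDerivAt_dy hU hz hj)).deriv
  have hp : jp (lambda₁ F₃ F₂ w z) j = _ :=
    ((((hasDerivAt_pow 2 j.2.2).const_mul (-F₃ (base j))).sub
      ((hasDerivAt_id j.2.2).const_mul (F₂ (base j) - w (base j)))).sub_const
      (z (base j))).deriv
  rw [total₁, hx, hy, hp]
  simp only [total]
  push_cast
  ring

/-- The partial derivatives of a cubic right hand side. -/
theorem jy_jp_of_cubic (hD : IsOpen D) (hU : IsOpen U) (hF₃ : ContDiffOn ℝ ∞ F₃ U)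
    (hF₂ : ContDiffOn ℝ ∞ F₂ U) (hF₁ : ContDiffOn ℝ ∞ F₁ U) (hF : ContDiffOn ℝ ∞ F U)
    (hc : ∀ j ∈ D, base j ∈ U → f j + F₃ (base j) * j.2.2 ^ 3 + F₂ (base j) * j.2.2 ^ 2 +
      F₁ (base j) * j.2.2 + F (base j) = 0) {j : ℝ × ℝ × ℝ} (hj : j ∈ D) (hjU : base j ∈ U) :
    jy f j = -(dy F₃ (base j) * j.2.2 ^ 3 + dy F₂ (base j) * j.2.2 ^ 2 + dy F₁ (base j) * j.2.2 +
        dy F (base j)) ∧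
      jp f j = -(3 * F₃ (base j) * j.2.2 ^ 2 + 2 * F₂ (base j) * j.2.2 + F₁ (base j)) := by
  have hW : IsOpen (D ∩ base ⁻¹' U) := hD.inter (hU.preimage continuous_base)
  have hEq : EqOn f (fun j => -(F₃ (base j) * j.2.2 ^ 3 + F₂ (base j) * j.2.2 ^ 2 +
      F₁ (base j) * j.2.2 + F (base j))) (D ∩ base ⁻¹' U) :=
    fun j hj => by linear_combination hc j hj.1 hj.2
  constructor
  · rw [jy_congr hW ⟨hj, hjU⟩ hEq]
    exact (((((hasDerivAt_dy hU hF₃ hjU).mul_const (j.2.2 ^ 3)).add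
      ((hasDerivAt_dy hU hF₂ hjU).mul_const (j.2.2 ^ 2))).add
      ((hasDerivAt_dy hU hF₁ hjU).mul_const j.2.2)).add (hasDerivAt_dy hU hF hjU)).neg.deriv
  · rw [jp_congr hW ⟨hj, hjU⟩ hEq]
    refine (((((hasDerivAt_pow 3 j.2.2).const_mul (F₃ (base j))).add
      ((hasDerivAt_pow 2 j.2.2).const_mul (F₂ (base j)))).add
      ((hasDerivAt_id j.2.2).const_mul (F₁ (base j)))).add_const
      (F (base j))).neg.deriv.trans ?_
    push_cast
    ring

end Determining

/-! ### The flatness equations -/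

/-- The integrability conditions, at `m`, of the system solved by `SolvesSystem`. -/
structure IsFlatAt (F₃ F₂ F₁ F w z : ℝ × ℝ → ℝ) (m : ℝ × ℝ) : Prop where
  quadratic : dy w m - dx F₃ m + F₃ m * (F₁ m - z m) - w m * (F₂ m - w m) = 0
  linear : dx w m - dy z m + dy F₁ m - dx F₂ m + 2 * F₃ m * F m - 2 * w m * z m = 0
  constant : dy F m - dx z m + F m * (F₂ m - w m) + z m ^ 2 - z m * F₁ m = 0
  trace : dx w m + dy z m = (1 / 3) * (dx F₂ m + dy F₁ m)

section Flatness

variable {D : Set (ℝ × ℝ × ℝ)} {f : ℝ × ℝ × ℝ → ℝ} {U : Set (ℝ × ℝ)}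
  {F₃ F₂ F₁ F w z : ℝ × ℝ → ℝ}

/-- The defect in the determining equation of `(∂_y, λ₁)` is a quadratic polynomial in `p`. -/
theorem determining_defect (hD : IsOpen D) (hU : IsOpen U) (hF₃ : ContDiffOn ℝ ∞ F₃ U)
    (hF₂ : ContDiffOn ℝ ∞ F₂ U) (hF₁ : ContDiffOn ℝ ∞ F₁ U) (hF : ContDiffOn ℝ ∞ F U)
    (hw : ContDiffOn ℝ ∞ w U) (hz : ContDiffOn ℝ ∞ z U)
    (hc : ∀ j ∈ D, base j ∈ U → f j + F₃ (base j) * j.2.2 ^ 3 + F₂ (base j) * j.2.2 ^ 2 +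
      F₁ (base j) * j.2.2 + F (base j) = 0) {j : ℝ × ℝ × ℝ} (hj : j ∈ D) (hjU : base j ∈ U) :
    total₁ (lambda₁ F₃ F₂ w z) j (f j) + lambda₁ F₃ F₂ w z j ^ 2 -
        (jy f j + lambda₁ F₃ F₂ w z j * jp f j) =
      (dy w (base j) - dx F₃ (base j) + F₃ (base j) * (F₁ (base j) - z (base j)) -
        w (base j) * (F₂ (base j) - w (base j))) * j.2.2 ^ 2 +
      (dx w (base j) - dy z (base j) + dy F₁ (base j) - dx F₂ (base j) +
        2 * F₃ (base j) * F (base j) - 2 * w (base j) * z (base j)) * j.2.2 +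
      (dy F (base j) - dx z (base j) + F (base j) * (F₂ (base j) - w (base j)) +
        z (base j) ^ 2 - z (base j) * F₁ (base j)) := by
  obtain ⟨h1, h2⟩ := jy_jp_of_cubic hD hU hF₃ hF₂ hF₁ hF hc hj hjU
  rw [total₁_lambda₁ hU hF₃ hF₂ hw hz hjU, h1, h2]
  simp only [total, lambda₁]
  -- The factor is ∂λ₁/∂p, the coefficient of f in A(λ₁). Once f is replaced by the cubic, the terms
  -- in p⁴ and p³ cancel.
  linear_combination (-(2 * F₃ (base j) * j.2.2 + (F₂ (base j) - w (base j)))) * hc j hj hjU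

/-- The determining equation holds on an open piece of the fibre through j, so each coefficient of
its quadratic defect vanishes. The trace equation is condition (c). A jet of D above the point is
indispensable to the argument. -/
theorem Criterion.isFlatAt (hD : IsOpen D) (hf : ContDiffOn ℝ ∞ f D) (hU : IsOpen U)
    (h : Criterion D f U F₃ F₂ F₁ F w z) {j : ℝ × ℝ × ℝ} (hj : j ∈ D) (hjU : base j ∈ U) :
    IsFlatAt F₃ F₂ F₁ F w z (base j) := by
  obtain ⟨ξ, η, l, hs, he⟩ := h.symmetry
  have key : ∀ᶠ s in 𝓝 j.2.2, _ := (eventually_fiber hD hj).mono fun s hsD => by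
    have h1 := hs.determining hD hf hU he
      (smooth_lambda₁ h.smooth_F₃ h.smooth_F₂ h.smooth_w h.smooth_z) hsD hjU
    have h2 := determining_defect hD hU h.smooth_F₃ h.smooth_F₂ h.smooth_F₁ h.smooth_F
      h.smooth_w h.smooth_z h.cubic hsD hjU
    exact h2.symm.trans (sub_eq_zero.2 h1)
  obtain ⟨h2, h1, h0⟩ := quadratic_coeffs_eq_zero (p := j.2.2)
    (a := dy w (base j) - dx F₃ (base j) + F₃ (base j) * (F₁ (base j) - z (base j)) -
      w (base j) * (F₂ (base j) - w (base j)))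
    (b := dx w (base j) - dy z (base j) + dy F₁ (base j) - dx F₂ (base j) +
      2 * F₃ (base j) * F (base j) - 2 * w (base j) * z (base j))
    (c := dy F (base j) - dx z (base j) + F (base j) * (F₂ (base j) - w (base j)) +
      z (base j) ^ 2 - z (base j) * F₁ (base j)) key
  exact ⟨h2, h1, h0, h.auxiliary _ hjU⟩

/-- The canonical pair of an equation with flat coefficients is a `λ`-symmetry. -/
theorem Criterion.of_flat (hD : IsOpen D) (hU : IsOpen U) (hF₃ : ContDiffOn ℝ ∞ F₃ U)
    (hF₂ : ContDiffOn ℝ ∞ F₂ U) (hF₁ : ContDiffOn ℝ ∞ F₁ U) (hF : ContDiffOn ℝ ∞ F U)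
    (hw : ContDiffOn ℝ ∞ w U) (hz : ContDiffOn ℝ ∞ z U)
    (hc : ∀ j ∈ D, base j ∈ U → f j + F₃ (base j) * j.2.2 ^ 3 + F₂ (base j) * j.2.2 ^ 2 +
      F₁ (base j) * j.2.2 + F (base j) = 0)
    (hflat : ∀ m ∈ U, IsFlatAt F₃ F₂ F₁ F w z m) : Criterion D f U F₃ F₂ F₁ F w z := by
  refine ⟨hF₃, hF₂, hF₁, hF, hw, hz, hc, ?_, fun m hm => (hflat m hm).trace⟩
  refine ⟨fun _ => 0, fun _ => 1, lambda₁ F₃ F₂ w z,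
    ⟨contDiffOn_const, contDiffOn_const, smooth_lambda₁ hF₃ hF₂ hw hz, ?_⟩, fun _ _ _ => rfl⟩
  rintro j hj hjU q rfl
  have h1 := determining_defect hD hU hF₃ hF₂ hF₁ hF hw hz hc hj hjU
  rw [(hflat _ hjU).quadratic, (hflat _ hjU).linear, (hflat _ hjU).constant] at h1
  rw [prolong₂_canonical, prolong₁_canonical]
  linear_combination h1

/-- Two independent solutions of the system transform a cubic equation into `u_tt = 0`. -/
theorem transformsTo_of_solvesSystem {V : Set (ℝ × ℝ)} {φ ψ : ℝ × ℝ → ℝ} (hV : IsOpen V)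
    (hc : ∀ j ∈ D, base j ∈ V → f j + F₃ (base j) * j.2.2 ^ 3 + F₂ (base j) * j.2.2 ^ 2 +
      F₁ (base j) * j.2.2 + F (base j) = 0)
    (hφ : SolvesSystem V F₃ F₂ F₁ F w z φ) (hψ : SolvesSystem V F₃ F₂ F₁ F w z ψ)
    (hJ : ∀ m ∈ V, jacobian φ ψ m ≠ 0) :
    TransformsTo D f V φ ψ (fun _ => 0) (fun _ => 0) (fun _ => 0) := by
  intro j hj hjV h0 q
  rw [newDeriv₂_eq hV hφ.smooth hψ.smooth hjV h0]
  -- Modulo the system, `total₂` of a solution is a combination of its S_x and S_y, so the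
  -- antisymmetric expression is a multiple of J; the remaining factor is q plus the cubic.
  have key : total φ j * total₂ ψ j q - total ψ j * total₂ φ j q =
      jacobian φ ψ (base j) * (q - f j) := by
    simp only [total, total₂, jacobian]
    linear_combination
      (dx φ (base j) + j.2.2 * dy φ (base j)) * (hψ.eq_xx _ hjV + 2 * j.2.2 * hψ.eq_xy _ hjV +
        j.2.2 ^ 2 * hψ.eq_yy _ hjV) -
      (dx ψ (base j) + j.2.2 * dy ψ (base j)) * (hφ.eq_xx _ hjV + 2 * j.2.2 * hφ.eq_xy _ hjV +
        j.2.2 ^ 2 * hφ.eq_yy _ hjV) +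
      (dx φ (base j) * dy ψ (base j) - dy φ (base j) * dx ψ (base j)) * hc j hj hjV
  rw [key]
  have hJ' := hJ _ hjV
  simp only [zero_mul, add_zero, div_eq_zero_iff, mul_eq_zero, hJ', false_or,
    pow_eq_zero_iff (three_ne_zero), h0, or_false, sub_eq_zero]

end Flatness

/-! ### Solving the system -/

section System

theorem fderiv_clm_apply_apply {E F G : Type*} [NormedAddCommGroup E] [NormedSpace ℝ E]
    [NormedAddCommGroup F] [NormedSpace ℝ F] [NormedAddCommGroup G] [NormedSpace ℝ G]
    {A : E → E →L[ℝ] F →L[ℝ] G} {m : E}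
    (hA : DifferentiableAt ℝ A m) (h k : E) (y : F) :
    fderiv ℝ A m h k y = fderiv ℝ (fun m => A m k y) m h := by
  have h1 : HasFDerivAt (fun m => A m k y) _ m :=
    (hA.hasFDerivAt.clm_apply (hasFDerivAt_const k m)).clm_apply (hasFDerivAt_const y m)
  rw [h1.fderiv]
  simp

open ContinuousLinearMap

/-- The second coordinate on `(S, S_x, S_y)`-space. -/
noncomputable abbrev stateP : ℝ × ℝ × ℝ →L[ℝ] ℝ := fst ℝ ℝ ℝ ∘L snd ℝ ℝ (ℝ × ℝ)

/-- The third coordinate on `(S, S_x, S_y)`-space. -/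
noncomputable abbrev stateQ : ℝ × ℝ × ℝ →L[ℝ] ℝ := snd ℝ ℝ ℝ ∘L snd ℝ ℝ (ℝ × ℝ)

/-- The elementary connection form `dx ⊗ (l ⊗ e)`. -/
noncomputable abbrev formX (l : ℝ × ℝ × ℝ →L[ℝ] ℝ) (e : ℝ × ℝ × ℝ) :
    ℝ × ℝ →L[ℝ] ℝ × ℝ × ℝ →L[ℝ] ℝ × ℝ × ℝ := (fst ℝ ℝ ℝ).smulRight (l.smulRight e)

/-- The elementary connection form `dy ⊗ (l ⊗ e)`. -/
noncomputable abbrev formY (l : ℝ × ℝ × ℝ →L[ℝ] ℝ) (e : ℝ × ℝ × ℝ) :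
    ℝ × ℝ →L[ℝ] ℝ × ℝ × ℝ →L[ℝ] ℝ × ℝ × ℝ := (snd ℝ ℝ ℝ).smulRight (l.smulRight e)

/-- The connection form of the system, written as a total differential equation for
`(S, S_x, S_y)`. -/
noncomputable def connection (F₃ F₂ F₁ F w z : ℝ × ℝ → ℝ) (m : ℝ × ℝ) :
    ℝ × ℝ →L[ℝ] ℝ × ℝ × ℝ →L[ℝ] ℝ × ℝ × ℝ :=
  (formX stateP (1, 0, 0) + formY stateQ (1, 0, 0)) - F₁ m • formX stateP (0, 1, 0) +
    F m • formX stateQ (0, 1, 0) - F₃ m • formY stateP (0, 0, 1) +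
    F₂ m • formY stateQ (0, 0, 1) -
    w m • (formX stateP (0, 0, 1) + formY stateP (0, 1, 0) + (2 : ℝ) • formY stateQ (0, 0, 1)) +
    z m • (formX stateQ (0, 0, 1) + formY stateQ (0, 1, 0) + (2 : ℝ) • formX stateP (0, 1, 0))

variable {U : Set (ℝ × ℝ)} {F₃ F₂ F₁ F w z : ℝ × ℝ → ℝ}

theorem smooth_linear_combination {G : Type*} [NormedAddCommGroup G] [NormedSpace ℝ G]
    (hF₃ : ContDiffOn ℝ ∞ F₃ U) (hF₂ : ContDiffOn ℝ ∞ F₂ U) (hF₁ : ContDiffOn ℝ ∞ F₁ U)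
    (hF : ContDiffOn ℝ ∞ F U) (hw : ContDiffOn ℝ ∞ w U) (hz : ContDiffOn ℝ ∞ z U)
    (c₀ c₁ c₂ c₃ c₄ c₅ c₆ : G) :
    ContDiffOn ℝ ∞ (fun m => c₀ - F₁ m • c₁ + F m • c₂ - F₃ m • c₃ + F₂ m • c₄ - w m • c₅ +
      z m • c₆) U :=
  (((((contDiffOn_const.sub (hF₁.smul contDiffOn_const)).add
    (hF.smul contDiffOn_const)).sub (hF₃.smul contDiffOn_const)).add
    (hF₂.smul contDiffOn_const)).sub (hw.smul contDiffOn_const)).add (hz.smul contDiffOn_const)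

/-- The rows are dS, dS_x and dS_y, with the second derivatives of S replaced by what the system
makes of them. -/
theorem connection_apply (m h : ℝ × ℝ) (y : ℝ × ℝ × ℝ) :
    connection F₃ F₂ F₁ F w z m h y =
      (h.1 * y.2.1 + h.2 * y.2.2,
        h.1 * ((2 * z m - F₁ m) * y.2.1 + F m * y.2.2) + h.2 * (z m * y.2.2 - w m * y.2.1),
        h.1 * (z m * y.2.2 - w m * y.2.1) + h.2 * ((F₂ m - 2 * w m) * y.2.2 - F₃ m * y.2.1)) := by
  ext <;> simp [connection] <;> ring

theorem smooth_connection (hF₃ : ContDiffOn ℝ ∞ F₃ U)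
    (hF₂ : ContDiffOn ℝ ∞ F₂ U) (hF₁ : ContDiffOn ℝ ∞ F₁ U) (hF : ContDiffOn ℝ ∞ F U)
    (hw : ContDiffOn ℝ ∞ w U) (hz : ContDiffOn ℝ ∞ z U) :
    ContDiffOn ℝ ∞ (connection F₃ F₂ F₁ F w z) U := by
  exact smooth_linear_combination hF₃ hF₂ hF₁ hF hw hz _ _ _ _ _ _ _

theorem fderiv_connection_apply (hU : IsOpen U) (hF₃ : ContDiffOn ℝ ∞ F₃ U)
    (hF₂ : ContDiffOn ℝ ∞ F₂ U) (hF₁ : ContDiffOn ℝ ∞ F₁ U) (hF : ContDiffOn ℝ ∞ F U)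
    (hw : ContDiffOn ℝ ∞ w U) (hz : ContDiffOn ℝ ∞ z U) {m : ℝ × ℝ} (hm : m ∈ U) (h k : ℝ × ℝ)
    (y : ℝ × ℝ × ℝ) :
    fderiv ℝ (connection F₃ F₂ F₁ F w z) m h k y =
      (0, k.1 * ((2 * (h.1 * dx z m + h.2 * dy z m) - (h.1 * dx F₁ m + h.2 * dy F₁ m)) * y.2.1 +
          (h.1 * dx F m + h.2 * dy F m) * y.2.2) +
        k.2 * ((h.1 * dx z m + h.2 * dy z m) * y.2.2 - (h.1 * dx w m + h.2 * dy w m) * y.2.1),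
        k.1 * ((h.1 * dx z m + h.2 * dy z m) * y.2.2 - (h.1 * dx w m + h.2 * dy w m) * y.2.1) +
        k.2 * (((h.1 * dx F₂ m + h.2 * dy F₂ m) - 2 * (h.1 * dx w m + h.2 * dy w m)) * y.2.2 -
          (h.1 * dx F₃ m + h.2 * dy F₃ m) * y.2.1)) := by
  have d3 := (differentiableAt_of_smooth hU hF₃ hm).hasFDerivAt
  have d2 := (differentiableAt_of_smooth hU hF₂ hm).hasFDerivAt
  have d1 := (differentiableAt_of_smooth hU hF₁ hm).hasFDerivAt
  have d0 := (differentiableAt_of_smooth hU hF hm).hasFDerivAt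
  have dw := (differentiableAt_of_smooth hU hw hm).hasFDerivAt
  have dz := (differentiableAt_of_smooth hU hz hm).hasFDerivAt
  have hd : DifferentiableAt ℝ (connection F₃ F₂ F₁ F w z) m :=
    ((smooth_connection hF₃ hF₂ hF₁ hF hw hz).contDiffAt (hU.mem_nhds hm)).differentiableAt
      (by simp)
  have e1 : HasFDerivAt (fun m => z m * y.2.2 - w m * y.2.1) _ m :=
    (dz.mul_const y.2.2).sub (dw.mul_const y.2.1)
  have e2 : HasFDerivAt (fun m => (2 * z m - F₁ m) * y.2.1 + F m * y.2.2) _ m :=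
    (((dz.const_mul 2).sub d1).mul_const y.2.1).add (d0.mul_const y.2.2)
  have e3 : HasFDerivAt (fun m => (F₂ m - 2 * w m) * y.2.2 - F₃ m * y.2.1) _ m :=
    ((d2.sub (dw.const_mul 2)).mul_const y.2.2).sub (d3.mul_const y.2.1)
  have key : HasFDerivAt (fun m => (k.1 * y.2.1 + k.2 * y.2.2,
      k.1 * ((2 * z m - F₁ m) * y.2.1 + F m * y.2.2) + k.2 * (z m * y.2.2 - w m * y.2.1),
      k.1 * (z m * y.2.2 - w m * y.2.1) + k.2 * ((F₂ m - 2 * w m) * y.2.2 - F₃ m * y.2.1))) _ m :=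
    (hasFDerivAt_const (k.1 * y.2.1 + k.2 * y.2.2) m).prodMk
      (((e2.const_mul k.1).add (e1.const_mul k.2)).prodMk
        ((e1.const_mul k.1).add (e3.const_mul k.2)))
  rw [fderiv_clm_apply_apply hd, funext fun m => connection_apply m k y, key.fderiv, ← apply_eq_of_hasFDerivAt d3,
    ← apply_eq_of_hasFDerivAt d2, ← apply_eq_of_hasFDerivAt d1, ← apply_eq_of_hasFDerivAt d0,
    ← apply_eq_of_hasFDerivAt dw, ← apply_eq_of_hasFDerivAt dz]
  simp only [ContinuousLinearMap.prod_apply, add_apply, sub_apply, smul_apply, zero_apply,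
    smul_eq_mul, Prod.mk.injEq]
  refine ⟨trivial, by ring, by ring⟩

/-- Only derivatives of S occur in the system, so the value of S at m₀ is free and the initial state
is (0, a, b). -/
theorem exists_solvesSystem (hU : IsOpen U) (hF₃ : ContDiffOn ℝ ∞ F₃ U)
    (hF₂ : ContDiffOn ℝ ∞ F₂ U) (hF₁ : ContDiffOn ℝ ∞ F₁ U) (hF : ContDiffOn ℝ ∞ F U)
    (hw : ContDiffOn ℝ ∞ w U) (hz : ContDiffOn ℝ ∞ z U)
    (hflat : ∀ m ∈ U, IsFlatAt F₃ F₂ F₁ F w z m) {m₀ : ℝ × ℝ} (hm₀ : m₀ ∈ U) (a b : ℝ) :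
    ∃ (V : Set (ℝ × ℝ)) (S : ℝ × ℝ → ℝ), IsOpen V ∧ m₀ ∈ V ∧ V ⊆ U ∧
      SolvesSystem V F₃ F₂ F₁ F w z S ∧ dx S m₀ = a ∧ dy S m₀ = b := by
  obtain ⟨V, Y, hV, hm₀V, hVU, hY0, -, hYd⟩ := exists_solution_of_flat hU
    (smooth_connection hF₃ hF₂ hF₁ hF hw hz) (fun m hm h k y => by
      obtain ⟨c2, c1, c0, ct⟩ := hflat m hm
      rw [fderiv_connection_apply hU hF₃ hF₂ hF₁ hF hw hz hm,
        fderiv_connection_apply hU hF₃ hF₂ hF₁ hF hw hz hm]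
      simp only [connection_apply, Prod.mk_add_mk, Prod.mk.injEq]
      refine ⟨by ring, ?_, ?_⟩
      -- Curvature is antisymmetric in h, k, hence a multiple of h.1 k.2 - h.2 k.1. Its diagonal
      -- entries are the half sum and half difference of `c1` and 3 `ct`, up to sign; `c0` and `c2`
      -- are the off-diagonal ones.
      · linear_combination (h.1 * k.2 - h.2 * k.1) *
          ((c1 / 2 - 3 / 2 * ct) * y.2.1 - c0 * y.2.2)
      · linear_combination (h.1 * k.2 - h.2 * k.1) *
          (c2 * y.2.1 - (c1 / 2 + 3 / 2 * ct) * y.2.2)) hm₀ ((0, a, b) : ℝ × ℝ × ℝ)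
  have hS : ∀ m ∈ V, HasFDerivAt (fun m => (Y m).1) _ m := fun m hm =>
    HasFDerivAt.fst (hYd m hm)
  have hP : ∀ m ∈ V, HasFDerivAt (fun m => (Y m).2.1) _ m := fun m hm =>
    HasFDerivAt.fst (HasFDerivAt.snd (hYd m hm))
  have hQ : ∀ m ∈ V, HasFDerivAt (fun m => (Y m).2.2) _ m := fun m hm =>
    HasFDerivAt.snd (HasFDerivAt.snd (hYd m hm))
  have hsm : ContDiffOn ℝ ∞ Y V :=
    contDiffOn_of_hasFDerivAt_linear hV
      ((smooth_connection hF₃ hF₂ hF₁ hF hw hz).mono hVU) hYd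
  have eP : EqOn (dx fun m => (Y m).1) (fun m => (Y m).2.1) V := fun m hm => by
    rw [dx_eq_of_hasFDerivAt (hS m hm)]; simp [connection_apply]
  have eQ : EqOn (dy fun m => (Y m).1) (fun m => (Y m).2.2) V := fun m hm => by
    rw [dy_eq_of_hasFDerivAt (hS m hm)]; simp [connection_apply]
  refine ⟨V, fun m => (Y m).1, hV, hm₀V, hVU, ⟨hsm.fst, fun m hm => ?_, fun m hm => ?_,
    fun m hm => ?_⟩, by simp [eP hm₀V, hY0], by simp [eQ hm₀V, hY0]⟩
  · rw [dy_congr hV hm eQ, eP hm, eQ hm, dy_eq_of_hasFDerivAt (hQ m hm)]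
    simp only [comp_apply, flip_apply, connection_apply, coe_snd']
    ring
  · rw [dy_congr hV hm eP, eP hm, eQ hm, dy_eq_of_hasFDerivAt (hP m hm)]
    simp only [comp_apply, flip_apply, connection_apply, coe_fst', coe_snd']
    ring
  · rw [dx_congr hV hm eP, eP hm, eQ hm, dx_eq_of_hasFDerivAt (hP m hm)]
    simp only [comp_apply, flip_apply, connection_apply, coe_fst', coe_snd']
    ring

/-- Initial gradients (1, 0) and (0, 1) give J = 1 at m₀, and J ≠ 0 is an open condition. -/
theorem exists_independent_solutions (hU : IsOpen U) (hF₃ : ContDiffOn ℝ ∞ F₃ U)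
    (hF₂ : ContDiffOn ℝ ∞ F₂ U) (hF₁ : ContDiffOn ℝ ∞ F₁ U) (hF : ContDiffOn ℝ ∞ F U)
    (hw : ContDiffOn ℝ ∞ w U) (hz : ContDiffOn ℝ ∞ z U)
    (hflat : ∀ m ∈ U, IsFlatAt F₃ F₂ F₁ F w z m) {m₀ : ℝ × ℝ} (hm₀ : m₀ ∈ U) :
    ∃ (V : Set (ℝ × ℝ)) (φ ψ : ℝ × ℝ → ℝ), IsOpen V ∧ m₀ ∈ V ∧ V ⊆ U ∧
      SolvesSystem V F₃ F₂ F₁ F w z φ ∧ SolvesSystem V F₃ F₂ F₁ F w z ψ ∧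
      ∀ m ∈ V, jacobian φ ψ m ≠ 0 := by
  obtain ⟨V₁, φ, hV₁, hm₁, hVU₁, hφ, hφx, hφy⟩ :=
    exists_solvesSystem hU hF₃ hF₂ hF₁ hF hw hz hflat hm₀ 1 0
  obtain ⟨V₂, ψ, hV₂, hm₂, hVU₂, hψ, hψx, hψy⟩ :=
    exists_solvesSystem hU hF₃ hF₂ hF₁ hF hw hz hflat hm₀ 0 1
  have hJ : ContinuousOn (jacobian φ ψ) (V₁ ∩ V₂) := by
    have h1 := (smooth_dx hV₁ hφ.smooth).continuousOn.mono (inter_subset_left (t := V₂))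
    have h2 := (smooth_dy hV₁ hφ.smooth).continuousOn.mono (inter_subset_left (t := V₂))
    have h3 := (smooth_dx hV₂ hψ.smooth).continuousOn.mono (inter_subset_right (s := V₁))
    have h4 := (smooth_dy hV₂ hψ.smooth).continuousOn.mono (inter_subset_right (s := V₁))
    exact (h1.mul h4).sub (h2.mul h3)
  refine ⟨(V₁ ∩ V₂) ∩ jacobian φ ψ ⁻¹' {0}ᶜ, φ, ψ,
    hJ.isOpen_inter_preimage (hV₁.inter hV₂) isOpen_compl_singleton,
    ⟨⟨hm₁, hm₂⟩, by simp [jacobian, hφx, hφy, hψx, hψy]⟩, fun m hm => hVU₁ hm.1.1,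
    ⟨hφ.smooth.mono fun m hm => hm.1.1, fun m hm => hφ.eq_yy m hm.1.1,
      fun m hm => hφ.eq_xy m hm.1.1, fun m hm => hφ.eq_xx m hm.1.1⟩,
    ⟨hψ.smooth.mono fun m hm => hm.1.2, fun m hm => hψ.eq_yy m hm.1.2,
      fun m hm => hψ.eq_xy m hm.1.2, fun m hm => hψ.eq_xx m hm.1.2⟩, fun m hm => hm.2⟩

end System

/-! ### Linearizable equations satisfy the criterion -/

section Riccati

/-- Local solvability of a Riccati equation with smooth coefficients. -/
theorem exists_riccati_solution {T : Set ℝ} (hT : IsOpen T) {a b : ℝ → ℝ}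
    (ha : ContDiffOn ℝ ∞ a T) (hb : ContDiffOn ℝ ∞ b T) {t₀ : ℝ} (ht₀ : t₀ ∈ T) :
    ∃ (I : Set ℝ) (ζ : ℝ → ℝ), IsOpen I ∧ t₀ ∈ I ∧ I ⊆ T ∧ ContDiffOn ℝ ∞ ζ I ∧
      ∀ t ∈ I, HasDerivAt ζ (ζ t ^ 2 + a t * ζ t - b t) t := by
  -- Time is added as a state coordinate to make the equation autonomous; the initial value 0 of ζ
  -- is arbitrary.
  have hv : ContDiffAt ℝ 1
      (fun x : ℝ × ℝ => ((1 : ℝ), x.2 ^ 2 + a x.1 * x.2 - b x.1)) (t₀, 0) := by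
    have ha' : ContDiffAt ℝ 1 (fun x : ℝ × ℝ => a x.1) (t₀, 0) :=
      ((contDiffOn_infty.1 ha 1).contDiffAt (hT.mem_nhds ht₀)).comp (t₀, (0 : ℝ)) contDiffAt_fst
    have hb' : ContDiffAt ℝ 1 (fun x : ℝ × ℝ => b x.1) (t₀, 0) :=
      ((contDiffOn_infty.1 hb 1).contDiffAt (hT.mem_nhds ht₀)).comp (t₀, (0 : ℝ)) contDiffAt_fst
    exact contDiffAt_const.prodMk
      (((contDiffAt_snd.pow 2).add (ha'.mul contDiffAt_snd)).sub hb')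
  obtain ⟨α, hα0, ε, hε, hα⟩ :=
    hv.exists_forall_mem_closedBall_exists_eq_forall_mem_Ioo_hasDerivAt₀ t₀
  have hα1 : ∀ t ∈ Ioo (t₀ - ε) (t₀ + ε), (α t).1 = t := by
    have h1 : ∀ t ∈ Ioo (t₀ - ε) (t₀ + ε), HasDerivAt (fun t => (α t).1 - t) 0 t := fun t ht => by
      have h3 : HasDerivAt (fun t => (α t).1) 1 t :=
        HasFDerivAt.comp_hasDerivAt (l := Prod.fst) (l' := ContinuousLinearMap.fst ℝ ℝ ℝ) t
          hasFDerivAt_fst (hα t ht)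
      have h4 := h3.sub (hasDerivAt_id t)
      rwa [sub_self] at h4
    intro t ht
    have h2 := isOpen_Ioo.is_const_of_deriv_eq_zero isPreconnected_Ioo
      (fun t ht => (h1 t ht).differentiableAt.differentiableWithinAt)
      (fun t ht => (h1 t ht).deriv) ht (show t₀ ∈ Ioo (t₀ - ε) (t₀ + ε) by constructor <;> linarith)
    simp only [hα0] at h2
    linarith
  have hζ : ∀ t ∈ T ∩ Ioo (t₀ - ε) (t₀ + ε),
      HasDerivAt (fun t => (α t).2) ((α t).2 ^ 2 + a t * (α t).2 - b t) t := fun t ht => by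
    have := HasFDerivAt.comp_hasDerivAt t hasFDerivAt_snd (hα t ht.2)
    rw [hα1 t ht.2] at this
    exact this
  have hI : IsOpen (T ∩ Ioo (t₀ - ε) (t₀ + ε)) := hT.inter isOpen_Ioo
  refine ⟨T ∩ Ioo (t₀ - ε) (t₀ + ε), fun t => (α t).2, hI,
    ⟨ht₀, by constructor <;> linarith⟩, inter_subset_left, ?_, hζ⟩
  have hd : DifferentiableOn ℝ (fun t => (α t).2) (T ∩ Ioo (t₀ - ε) (t₀ + ε)) :=
    fun t ht => (hζ t ht).differentiableAt.differentiableWithinAt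
  rw [contDiffOn_infty]
  intro n
  induction n with
  | zero => exact contDiffOn_zero.2 hd.continuousOn
  | succ n ih =>
    push_cast
    rw [contDiffOn_succ_iff_deriv_of_isOpen hI]
    refine ⟨hd, by simp, ?_⟩
    exact (((ih.pow 2).add (((contDiffOn_infty.1 ha n).mono inter_subset_left).mul ih)).sub
      ((contDiffOn_infty.1 hb n).mono inter_subset_left)).congr fun t ht => (hζ t ht).deriv

end Riccati

/-! ### Compatibility of third derivatives -/

section Integrability

variable {V : Set (ℝ × ℝ)} {F₃ F₂ F₁ F w z S Exx Exy Eyy : ℝ × ℝ → ℝ}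

/-- `S` satisfies the system with inhomogeneous terms `Exx`, `Exy`, `Eyy`. -/
structure SolvesInhomogeneous (V : Set (ℝ × ℝ)) (F₃ F₂ F₁ F w z S Exx Exy Eyy : ℝ × ℝ → ℝ) :
    Prop where
  smooth : ContDiffOn ℝ ∞ S V
  eq_xx : ∀ m ∈ V, dx (dx S) m = (2 * z m - F₁ m) * dx S m + F m * dy S m - Exx m
  eq_xy : ∀ m ∈ V, dy (dx S) m = -w m * dx S m + z m * dy S m - Exy m
  eq_yy : ∀ m ∈ V, dy (dy S) m = -F₃ m * dx S m + (F₂ m - 2 * w m) * dy S m - Eyy m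

/-- The consequence of the commutation of third derivatives for a solution of the inhomogeneous
system. -/
theorem SolvesInhomogeneous.integrability (hV : IsOpen V) (hF₃ : ContDiffOn ℝ ∞ F₃ V)
    (hF₂ : ContDiffOn ℝ ∞ F₂ V) (hF₁ : ContDiffOn ℝ ∞ F₁ V) (hF : ContDiffOn ℝ ∞ F V)
    (hw : ContDiffOn ℝ ∞ w V) (hz : ContDiffOn ℝ ∞ z V) (hxx : ContDiffOn ℝ ∞ Exx V)
    (hxy : ContDiffOn ℝ ∞ Exy V) (hyy : ContDiffOn ℝ ∞ Eyy V)
    (h : SolvesInhomogeneous V F₃ F₂ F₁ F w z S Exx Exy Eyy) {m : ℝ × ℝ} (hm : m ∈ V) :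
    dy Exx m - dx Exy m + (2 * z m - F₁ m) * Exy m + F m * Eyy m + w m * Exx m - z m * Exy m =
        (2 * dy z m - dy F₁ m + dx w m + w m * z m - F m * F₃ m) * dx S m +
        (dy F m - dx z m + F m * (F₂ m - w m) + z m ^ 2 - z m * F₁ m) * dy S m ∧
      dx Eyy m - dy Exy m - F₃ m * Exx m + (F₂ m - 2 * w m) * Exy m + w m * Exy m - z m * Eyy m =
        (dy w m - dx F₃ m + F₃ m * (F₁ m - z m) - w m * (F₂ m - w m)) * dx S m +
        (dx F₂ m - 2 * dx w m - dy z m - F₃ m * F m + w m * z m) * dy S m := by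
  have hSx := smooth_dx hV h.smooth
  have hSy := smooth_dy hV h.smooth
  have c1 := dx_dy_comm hV hSx hm
  have c2 : dx (dy (dy S)) m = dy (dy (dx S)) m := by
    rw [dx_dy_comm hV hSy hm]
    exact dy_congr hV hm fun m hm => dx_dy_comm hV h.smooth hm
  have exx_y : dy (dx (dx S)) m = _ := (dy_congr hV hm h.eq_xx).trans
    ((((((hasDerivAt_dy hV hz hm).const_mul 2).sub (hasDerivAt_dy hV hF₁ hm)).mul
      (hasDerivAt_dy hV hSx hm)).add
      ((hasDerivAt_dy hV hF hm).mul (hasDerivAt_dy hV hSy hm))).sub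
      (hasDerivAt_dy hV hxx hm)).deriv
  have exy_x : dx (dy (dx S)) m = _ := (dx_congr hV hm h.eq_xy).trans
    ((((hasDerivAt_dx hV hw hm).neg.mul (hasDerivAt_dx hV hSx hm)).add
      ((hasDerivAt_dx hV hz hm).mul (hasDerivAt_dx hV hSy hm))).sub
      (hasDerivAt_dx hV hxy hm)).deriv
  have exy_y : dy (dy (dx S)) m = _ := (dy_congr hV hm h.eq_xy).trans
    ((((hasDerivAt_dy hV hw hm).neg.mul (hasDerivAt_dy hV hSx hm)).add
      ((hasDerivAt_dy hV hz hm).mul (hasDerivAt_dy hV hSy hm))).sub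
      (hasDerivAt_dy hV hxy hm)).deriv
  have eyy_x : dx (dy (dy S)) m = _ := (dx_congr hV hm h.eq_yy).trans
    ((((hasDerivAt_dx hV hF₃ hm).neg.mul (hasDerivAt_dx hV hSx hm)).add
      (((hasDerivAt_dx hV hF₂ hm).sub ((hasDerivAt_dx hV hw hm).const_mul 2)).mul
      (hasDerivAt_dx hV hSy hm))).sub (hasDerivAt_dx hV hyy hm)).deriv
  rw [exx_y, exy_x] at c1
  rw [eyy_x, exy_y] at c2
  -- Second derivatives of S are reinserted from the system, leaving identities in S_x, S_y and the
  -- inhomogeneous terms.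
  simp only [dx_dy_comm hV h.smooth hm, h.eq_xx m hm, h.eq_xy m hm, h.eq_yy m hm,
    Prod.mk.eta, Pi.neg_apply, Pi.sub_apply] at c1 c2
  constructor
  · linear_combination c1
  · linear_combination -c2

end Integrability

/-! ### Flatness of the connection pulled back from a linear equation -/

section Transformed

variable {V : Set (ℝ × ℝ)} {F₃ F₂ F₁ F w z φ ψ α β ζ : ℝ × ℝ → ℝ} {m : ℝ × ℝ}

theorem dx_mul_mul {P Q : ℝ × ℝ → ℝ} (hV : IsOpen V) (hα : ContDiffOn ℝ ∞ α V)
    (hP : ContDiffOn ℝ ∞ P V) (hQ : ContDiffOn ℝ ∞ Q V) (hm : m ∈ V) :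
    dx (fun m => α m * (P m * Q m)) m =
      dx α m * (P m * Q m) + α m * (dx P m * Q m + P m * dx Q m) :=
  ((hasDerivAt_dx hV hα hm).mul ((hasDerivAt_dx hV hP hm).mul (hasDerivAt_dx hV hQ hm))).deriv

theorem dy_mul_mul {P Q : ℝ × ℝ → ℝ} (hV : IsOpen V) (hα : ContDiffOn ℝ ∞ α V)
    (hP : ContDiffOn ℝ ∞ P V) (hQ : ContDiffOn ℝ ∞ Q V) (hm : m ∈ V) :
    dy (fun m => α m * (P m * Q m)) m =
      dy α m * (P m * Q m) + α m * (dy P m * Q m + P m * dy Q m) :=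
  ((hasDerivAt_dy hV hα hm).mul ((hasDerivAt_dy hV hP hm).mul (hasDerivAt_dy hV hQ hm))).deriv

theorem dx_bilinear {P Q R S : ℝ × ℝ → ℝ} (hV : IsOpen V) (hζ : ContDiffOn ℝ ∞ ζ V)
    (hβ : ContDiffOn ℝ ∞ β V) (hP : ContDiffOn ℝ ∞ P V) (hQ : ContDiffOn ℝ ∞ Q V)
    (hR : ContDiffOn ℝ ∞ R V) (hS : ContDiffOn ℝ ∞ S V) (hm : m ∈ V) :
    dx (fun m => ζ m * (P m * S m) + ζ m * (R m * Q m) - β m * (P m * Q m)) m =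
      dx ζ m * (P m * S m) + ζ m * (dx P m * S m + P m * dx S m) +
      (dx ζ m * (R m * Q m) + ζ m * (dx R m * Q m + R m * dx Q m)) -
      (dx β m * (P m * Q m) + β m * (dx P m * Q m + P m * dx Q m)) :=
  ((((hasDerivAt_dx hV hζ hm).mul ((hasDerivAt_dx hV hP hm).mul (hasDerivAt_dx hV hS hm))).add
    ((hasDerivAt_dx hV hζ hm).mul ((hasDerivAt_dx hV hR hm).mul (hasDerivAt_dx hV hQ hm)))).sub
    ((hasDerivAt_dx hV hβ hm).mul ((hasDerivAt_dx hV hP hm).mul (hasDerivAt_dx hV hQ hm)))).deriv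

theorem dy_bilinear {P Q R S : ℝ × ℝ → ℝ} (hV : IsOpen V) (hζ : ContDiffOn ℝ ∞ ζ V)
    (hβ : ContDiffOn ℝ ∞ β V) (hP : ContDiffOn ℝ ∞ P V) (hQ : ContDiffOn ℝ ∞ Q V)
    (hR : ContDiffOn ℝ ∞ R V) (hS : ContDiffOn ℝ ∞ S V) (hm : m ∈ V) :
    dy (fun m => ζ m * (P m * S m) + ζ m * (R m * Q m) - β m * (P m * Q m)) m =
      dy ζ m * (P m * S m) + ζ m * (dy P m * S m + P m * dy S m) +
      (dy ζ m * (R m * Q m) + ζ m * (dy R m * Q m + R m * dy Q m)) -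
      (dy β m * (P m * Q m) + β m * (dy P m * Q m + P m * dy Q m)) :=
  ((((hasDerivAt_dy hV hζ hm).mul ((hasDerivAt_dy hV hP hm).mul (hasDerivAt_dy hV hS hm))).add
    ((hasDerivAt_dy hV hζ hm).mul ((hasDerivAt_dy hV hR hm).mul (hasDerivAt_dy hV hQ hm)))).sub
    ((hasDerivAt_dy hV hβ hm).mul ((hasDerivAt_dy hV hP hm).mul (hasDerivAt_dy hV hQ hm)))).deriv

theorem eq_zero_of_jacobian_ne {a b : ℝ} (hJ : jacobian φ ψ m ≠ 0)
    (h₁ : a * dx φ m + b * dy φ m = 0) (h₂ : a * dx ψ m + b * dy ψ m = 0) : a = 0 ∧ b = 0 := by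
  constructor
  · refine (mul_eq_zero.1 (?_ : a * jacobian φ ψ m = 0)).resolve_right hJ
    rw [jacobian]
    linear_combination dy ψ m * h₁ - dy φ m * h₂
  · refine (mul_eq_zero.1 (?_ : b * jacobian φ ψ m = 0)).resolve_right hJ
    rw [jacobian]
    linear_combination dx φ m * h₂ - dx ψ m * h₁

/-- The pull back of the connection of a linear equation is flat. -/
theorem isFlatAt_of_solvesInhomogeneous (hV : IsOpen V) (hF₃ : ContDiffOn ℝ ∞ F₃ V)
    (hF₂ : ContDiffOn ℝ ∞ F₂ V) (hF₁ : ContDiffOn ℝ ∞ F₁ V) (hF : ContDiffOn ℝ ∞ F V)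
    (hw : ContDiffOn ℝ ∞ w V) (hz : ContDiffOn ℝ ∞ z V) (hα : ContDiffOn ℝ ∞ α V)
    (hβ : ContDiffOn ℝ ∞ β V) (hζ : ContDiffOn ℝ ∞ ζ V)
    (hφ : SolvesInhomogeneous V F₃ F₂ F₁ F w z φ (fun m => α m * (dx φ m * dx φ m))
      (fun m => α m * (dx φ m * dy φ m)) (fun m => α m * (dy φ m * dy φ m)))
    (hψ : SolvesInhomogeneous V F₃ F₂ F₁ F w z ψ
      (fun m => ζ m * (dx φ m * dx ψ m) + ζ m * (dx ψ m * dx φ m) - β m * (dx φ m * dx φ m))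
      (fun m => ζ m * (dx φ m * dy ψ m) + ζ m * (dx ψ m * dy φ m) - β m * (dx φ m * dy φ m))
      (fun m => ζ m * (dy φ m * dy ψ m) + ζ m * (dy ψ m * dy φ m) - β m * (dy φ m * dy φ m)))
    (hm : m ∈ V) (hJ : jacobian φ ψ m ≠ 0) {a b κ : ℝ} (hαx : dx α m = a * dx φ m)
    (hαy : dy α m = a * dy φ m) (hβx : dx β m = κ * dx φ m + b * dx ψ m)
    (hβy : dy β m = κ * dy φ m + b * dy ψ m)
    (hζx : dx ζ m = (α m * ζ m - ζ m ^ 2 - b) * dx φ m)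
    (hζy : dy ζ m = (α m * ζ m - ζ m ^ 2 - b) * dy φ m) :
    IsFlatAt F₃ F₂ F₁ F w z m := by
  have hφx := smooth_dx hV hφ.smooth
  have hφy := smooth_dy hV hφ.smooth
  have hψx := smooth_dx hV hψ.smooth
  have hψy := smooth_dy hV hψ.smooth
  obtain ⟨i1, i2⟩ := hφ.integrability hV hF₃ hF₂ hF₁ hF hw hz (hα.mul (hφx.mul hφx))
    (hα.mul (hφx.mul hφy)) (hα.mul (hφy.mul hφy)) hm
  obtain ⟨k1, k2⟩ := hψ.integrability hV hF₃ hF₂ hF₁ hF hw hz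
    (((hζ.mul (hφx.mul hψx)).add (hζ.mul (hψx.mul hφx))).sub (hβ.mul (hφx.mul hφx)))
    (((hζ.mul (hφx.mul hψy)).add (hζ.mul (hψx.mul hφy))).sub (hβ.mul (hφx.mul hφy)))
    (((hζ.mul (hφy.mul hψy)).add (hζ.mul (hψy.mul hφy))).sub (hβ.mul (hφy.mul hφy))) hm
  rw [dy_mul_mul hV hα hφx hφx hm, dx_mul_mul hV hα hφx hφy hm, hαx, hαy,
    dx_dy_comm hV hφ.smooth hm] at i1
  rw [dx_mul_mul hV hα hφy hφy hm, dy_mul_mul hV hα hφx hφy hm, hαx, hαy,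
    dx_dy_comm hV hφ.smooth hm] at i2
  rw [dy_bilinear hV hζ hβ hφx hφx hψx hψx hm, dx_bilinear hV hζ hβ hφx hφy hψx hψy hm, hβx, hβy,
    hζx, hζy, dx_dy_comm hV hφ.smooth hm, dx_dy_comm hV hψ.smooth hm] at k1
  rw [dx_bilinear hV hζ hβ hφy hφy hψy hψy hm, dy_bilinear hV hζ hβ hφx hφy hψx hψy hm, hβx, hβy,
    hζx, hζy, dx_dy_comm hV hφ.smooth hm, dx_dy_comm hV hψ.smooth hm] at k2
  have rxx := hφ.eq_xx m hm
  have rxy := hφ.eq_xy m hm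
  have ryy := hφ.eq_yy m hm
  have sxx := hψ.eq_xx m hm
  have sxy := hψ.eq_xy m hm
  have syy := hψ.eq_yy m hm
  -- Both dφ and dψ are annihilated by a row of the curvature. For φ this uses that dα is parallel
  -- to dφ. For ψ, κ drops out by antisymmetry, and the Riccati equation for ζ cancels b and the
  -- remaining αζ - ζ².
  obtain ⟨p1, c0⟩ := eq_zero_of_jacobian_ne hJ
    (a := 2 * dy z m - dy F₁ m + dx w m + w m * z m - F m * F₃ m)
    (b := dy F m - dx z m + F m * (F₂ m - w m) + z m ^ 2 - z m * F₁ m)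
    (by linear_combination α m * (dx φ m * rxy - dy φ m * rxx) - i1)
    (by linear_combination (ζ m * dx ψ m - β m * dx φ m) * rxy + ζ m * dx φ m * sxy -
          (ζ m * dy ψ m - β m * dy φ m) * rxx - ζ m * dy φ m * sxx - k1)
  obtain ⟨c2, q2⟩ := eq_zero_of_jacobian_ne hJ
    (a := dy w m - dx F₃ m + F₃ m * (F₁ m - z m) - w m * (F₂ m - w m))
    (b := dx F₂ m - 2 * dx w m - dy z m - F₃ m * F m + w m * z m)
    (by linear_combination α m * (dy φ m * rxy - dx φ m * ryy) - i2)
    (by linear_combination (ζ m * dy ψ m - β m * dy φ m) * rxy + ζ m * dy φ m * sxy -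
          (ζ m * dx ψ m - β m * dx φ m) * ryy - ζ m * dx φ m * syy - k2)
  exact ⟨c2, by linear_combination -p1 - q2, c0, by linear_combination (p1 - q2) / 3⟩

/-- Cramer's rule with smooth coefficients. -/
theorem exists_smooth_cramer {H K : ℝ × ℝ → ℝ} (hV : IsOpen V)
    (hT : IsPointTransformation V φ ψ) (hH : ContDiffOn ℝ ∞ H V) (hK : ContDiffOn ℝ ∞ K V) :
    ∃ g₁ g₂ : ℝ × ℝ → ℝ, ContDiffOn ℝ ∞ g₁ V ∧ ContDiffOn ℝ ∞ g₂ V ∧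
      ∀ m ∈ V, g₁ m * dx φ m + g₂ m * dy φ m = H m ∧ g₁ m * dx ψ m + g₂ m * dy ψ m = K m := by
  have hφx := smooth_dx hV hT.smooth_fst
  have hφy := smooth_dy hV hT.smooth_fst
  have hψx := smooth_dx hV hT.smooth_snd
  have hψy := smooth_dy hV hT.smooth_snd
  have hJ : ContDiffOn ℝ ∞ (jacobian φ ψ) V := (hφx.mul hψy).sub (hφy.mul hψx)
  refine ⟨fun m => (H m * dy ψ m - K m * dy φ m) / jacobian φ ψ m,
    fun m => (dx φ m * K m - dx ψ m * H m) / jacobian φ ψ m,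
    ((hH.mul hψy).sub (hK.mul hφy)).div hJ hT.jacobian_ne,
    ((hφx.mul hK).sub (hψx.mul hH)).div hJ hT.jacobian_ne, fun m hm => ?_⟩
  have h0 := hT.jacobian_ne m hm
  constructor
  · field_simp
    rw [jacobian]
    ring
  · field_simp
    rw [jacobian]
    ring

theorem dx_comp {g : ℝ → ℝ} {g' : ℝ} (hV : IsOpen V) (hφ : ContDiffOn ℝ ∞ φ V) (hm : m ∈ V)
    (hg : HasDerivAt g g' (φ m)) : dx (fun m => g (φ m)) m = g' * dx φ m :=
  (HasDerivAt.comp (h₂ := g) m.1 hg (hasDerivAt_dx hV hφ hm)).deriv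

theorem dy_comp {g : ℝ → ℝ} {g' : ℝ} (hV : IsOpen V) (hφ : ContDiffOn ℝ ∞ φ V) (hm : m ∈ V)
    (hg : HasDerivAt g g' (φ m)) : dy (fun m => g (φ m)) m = g' * dy φ m :=
  (HasDerivAt.comp (h₂ := g) m.2 hg (hasDerivAt_dy hV hφ hm)).deriv

/-- An identity between continuous functions of the jet which holds where `D_x φ ≠ 0` holds
everywhere. -/
theorem eq_zero_of_total_ne {W : Set (ℝ × ℝ × ℝ)} (hW : IsOpen W) {G : ℝ × ℝ × ℝ → ℝ}
    (hG : ContinuousOn G W) (h : ∀ j ∈ W, total φ j ≠ 0 → G j = 0) {j : ℝ × ℝ × ℝ} (hj : j ∈ W)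
    (hJ : jacobian φ ψ (base j) ≠ 0) : G j = 0 := by
  by_cases h0 : total φ j ≠ 0
  · exact h j hj h0
  push Not at h0
  -- At such a jet J ≠ 0 forces φ_y ≠ 0, so along the fibre D_xφ is affine in p with this single
  -- zero, and G vanishes here by continuity.
  have hφy : dy φ (base j) ≠ 0 := by
    intro hy
    apply hJ
    have hx : dx φ (base j) = 0 := by
      rw [total] at h0
      linear_combination h0 - j.2.2 * hy
    rw [jacobian, hx, hy]
    ring
  have hc : ContinuousAt (fun s => G (j.1, j.2.1, s)) j.2.2 :=
    ContinuousAt.comp (f := fun s => (j.1, j.2.1, s)) (hG.continuousAt (hW.mem_nhds hj))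
      (by fun_prop)
  have h1 : Filter.Tendsto (fun s => G (j.1, j.2.1, s)) (𝓝[≠] j.2.2) (𝓝 (G j)) :=
    hc.tendsto.mono_left nhdsWithin_le_nhds
  refine tendsto_nhds_unique (h1.congr' ?_) tendsto_const_nhds
  filter_upwards [nhdsWithin_le_nhds (eventually_fiber hW hj), self_mem_nhdsWithin] with s hs hne
  refine h _ hs fun h2 => hne ?_
  have h3 : (s - j.2.2) * dy φ (base j) = 0 := by
    have h2' : dx φ (base j) + s * dy φ (base j) = 0 := h2
    rw [total] at h0
    linear_combination h2' - h0
  exact sub_eq_zero.1 ((mul_eq_zero.1 h3).resolve_right hφy)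

end Transformed

/-- The required functions are read off from the Christoffel symbols of the pulled-back flat
connection, found by requiring the prescribed Hessians of φ and ψ. -/
theorem LinearizableAt.exists_criterion {D : Set (ℝ × ℝ × ℝ)} (hD : IsOpen D)
    {f : ℝ × ℝ × ℝ → ℝ} (hf : ContDiffOn ℝ ∞ f D) {m₀ : ℝ × ℝ} (h : LinearizableAt D f m₀) :
    ∃ (U : Set (ℝ × ℝ)) (F₃ F₂ F₁ F w z : ℝ × ℝ → ℝ),
      IsOpen U ∧ m₀ ∈ U ∧ Criterion D f U F₃ F₂ F₁ F w z := by
  obtain ⟨U, φ, ψ, T, a, b, c, hU, hm₀, hP, hT, hφT, ha, hb, hc, htr⟩ := h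
  obtain ⟨I, ζ, hI, ht₀, hIT, hζ, hζ'⟩ := exists_riccati_solution hT ha hb (hφT hm₀)
  have hV : IsOpen (U ∩ φ ⁻¹' I) := hP.smooth_fst.continuousOn.isOpen_inter_preimage hU hI
  have hm₀V : m₀ ∈ U ∩ φ ⁻¹' I := ⟨hm₀, ht₀⟩
  have hVU : U ∩ φ ⁻¹' I ⊆ U := inter_subset_left
  have hVI : MapsTo φ (U ∩ φ ⁻¹' I) I := fun m hm => hm.2
  generalize U ∩ φ ⁻¹' I = V at hV hm₀V hVU hVI
  have hφ := hP.smooth_fst.mono hVU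
  have hψ := hP.smooth_snd.mono hVU
  have hPV : IsPointTransformation V φ ψ := ⟨hφ, hψ, fun m hm => hP.jacobian_ne m (hVU hm)⟩
  have hφx := smooth_dx hV hφ
  have hφy := smooth_dy hV hφ
  have hψx := smooth_dx hV hψ
  have hψy := smooth_dy hV hψ
  have hVT : MapsTo φ V T := fun m hm => hIT (hVI hm)
  have hZ : ContDiffOn ℝ ∞ (fun m => ζ (φ m)) V := hζ.comp hφ hVI
  have hA : ContDiffOn ℝ ∞ (fun m => a (φ m) + 2 * ζ (φ m)) V :=
    (ha.comp hφ hVT).add (contDiffOn_const.mul hZ)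
  have hB : ContDiffOn ℝ ∞ (fun m => b (φ m) * ψ m + c (φ m)) V :=
    ((hb.comp hφ hVT).mul hψ).add (hc.comp hφ hVT)
  have hbil : ∀ {P Q R S : ℝ × ℝ → ℝ}, ContDiffOn ℝ ∞ P V → ContDiffOn ℝ ∞ Q V →
      ContDiffOn ℝ ∞ R V → ContDiffOn ℝ ∞ S V → ContDiffOn ℝ ∞ (fun m =>
        ζ (φ m) * (P m * S m) + ζ (φ m) * (R m * Q m) -
          (b (φ m) * ψ m + c (φ m)) * (P m * Q m)) V := fun hP hQ hR hS =>
    ((hZ.mul (hP.mul hS)).add (hZ.mul (hR.mul hQ))).sub (hB.mul (hP.mul hQ))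
  -- Each pair (g, k) holds the symbols with the indicated lower indices. It is determined by one
  -- equation for φ and one for ψ, with determinant J.
  obtain ⟨gxx, kxx, hgxx, hkxx, exx⟩ := exists_smooth_cramer hV hPV
    ((smooth_dx hV hφx).add (hA.mul (hφx.mul hφx)))
    ((smooth_dx hV hψx).add (hbil hφx hφx hψx hψx))
  obtain ⟨gxy, kxy, hgxy, hkxy, exy⟩ := exists_smooth_cramer hV hPV
    ((smooth_dy hV hφx).add (hA.mul (hφx.mul hφy)))
    ((smooth_dy hV hψx).add (hbil hφx hφy hψx hψy))
  obtain ⟨gyy, kyy, hgyy, hkyy, eyy⟩ := exists_smooth_cramer hV hPV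
    ((smooth_dy hV hφy).add (hA.mul (hφy.mul hφy)))
    ((smooth_dy hV hψy).add (hbil hφy hφy hψy hψy))
  have hF₂ : ContDiffOn ℝ ∞ (fun m => kyy m + 2 * (-gxy m)) V :=
    hkyy.add (contDiffOn_const.mul hgxy.neg)
  have hF₁ : ContDiffOn ℝ ∞ (fun m => 2 * kxy m - gxx m) V :=
    (contDiffOn_const.mul hkxy).sub hgxx
  -- These choices match the coefficients in `SolvesInhomogeneous`: 2z - F₁ = gxx, F = kxx, -w =
  -- gxy, z = kxy, -F₃ = gyy, F₂ - 2w = kyy.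
  refine ⟨V, fun m => -gyy m, fun m => kyy m + 2 * (-gxy m), fun m => 2 * kxy m - gxx m, kxx,
    fun m => -gxy m, kxy, hV, hm₀V, Criterion.of_flat hD hV hgyy.neg hF₂ hF₁ hkxx hgxy.neg hkxy
      ?_ ?_⟩
  · intro j hj hjV
    have hW : IsOpen (D ∩ base ⁻¹' V) := hD.inter (hV.preimage continuous_base)
    have hb' : MapsTo base (D ∩ base ⁻¹' V) V := fun _ h => h.2
    have hcb := continuous_base.continuousOn (s := D ∩ base ⁻¹' V)
    have hp : ContinuousOn (fun j : ℝ × ℝ × ℝ => j.2.2) (D ∩ base ⁻¹' V) := by fun_prop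
    refine eq_zero_of_total_ne (φ := φ) (ψ := ψ) (G := fun j => f j + -gyy (base j) * j.2.2 ^ 3 +
      (kyy (base j) + 2 * (-gxy (base j))) * j.2.2 ^ 2 +
      (2 * kxy (base j) - gxx (base j)) * j.2.2 + kxx (base j)) hW ?_ ?_ ⟨hj, hjV⟩
      (hPV.jacobian_ne _ hjV)
    · exact ((((hf.continuousOn.mono inter_subset_left).add
        ((hgyy.neg.continuousOn.comp hcb hb').mul (hp.pow 3))).add
        ((hF₂.continuousOn.comp hcb hb').mul (hp.pow 2))).add
        ((hF₁.continuousOn.comp hcb hb').mul hp)).add (hkxx.continuousOn.comp hcb hb')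
    · rintro j ⟨hj, hjV⟩ h0
      have hjV : base j ∈ V := hjV
      have h1 := (htr j hj (hVU hjV) h0 (f j)).1 rfl
      rw [newDeriv₂_eq hV hφ hψ hjV h0, newDeriv] at h1
      obtain ⟨x1, x2⟩ := exx _ hjV
      obtain ⟨y1, y2⟩ := exy _ hjV
      obtain ⟨z1, z2⟩ := eyy _ hjV
      field_simp at h1
      refine (mul_eq_zero.1 (?_ : jacobian φ ψ (base j) * _ = 0)).resolve_left
        (hPV.jacobian_ne _ hjV)
      simp only [total, total₂, jacobian] at h1 ⊢
      -- The contributions of ζ to the Hessians of φ and ψ cancel here: ζ changes the connection but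
      -- not its unparametrized geodesics.
      linear_combination h1 +
        (dx φ (base j) + j.2.2 * dy φ (base j)) * (x2 + 2 * j.2.2 * y2 + j.2.2 ^ 2 * z2) -
        (dx ψ (base j) + j.2.2 * dy ψ (base j)) * (x1 + 2 * j.2.2 * y1 + j.2.2 ^ 2 * z1)
  · intro m hm
    have hζm := hζ' _ (hVI hm)
    have hda : HasDerivAt a (deriv a (φ m)) (φ m) :=
      ((ha.contDiffAt (hT.mem_nhds (hVT hm))).differentiableAt (by simp)).hasDerivAt
    have hdb : HasDerivAt b (deriv b (φ m)) (φ m) :=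
      ((hb.contDiffAt (hT.mem_nhds (hVT hm))).differentiableAt (by simp)).hasDerivAt
    have hdc : HasDerivAt c (deriv c (φ m)) (φ m) :=
      ((hc.contDiffAt (hT.mem_nhds (hVT hm))).differentiableAt (by simp)).hasDerivAt
    have hdα := hda.add (hζm.const_mul 2)
    refine isFlatAt_of_solvesInhomogeneous (φ := φ) (ψ := ψ)
      (α := fun m => a (φ m) + 2 * ζ (φ m)) (β := fun m => b (φ m) * ψ m + c (φ m))
      (ζ := fun m => ζ (φ m)) (b := b (φ m)) (κ := deriv b (φ m) * ψ m + deriv c (φ m))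
      hV hgyy.neg hF₂ hF₁ hkxx hgxy.neg hkxy hA hB hZ ⟨hφ, fun m hm => ?_, fun m hm => ?_,
        fun m hm => ?_⟩ ⟨hψ, fun m hm => ?_, fun m hm => ?_, fun m hm => ?_⟩ hm
      (hPV.jacobian_ne m hm) (dx_comp hV hφ hm hdα) (dy_comp hV hφ hm hdα) ?_ ?_ ?_ ?_
    · linear_combination -(exx m hm).1
    · linear_combination -(exy m hm).1
    · linear_combination -(eyy m hm).1
    · linear_combination -(exx m hm).2
    · linear_combination -(exy m hm).2
    · linear_combination -(eyy m hm).2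
    · have hx := (((HasDerivAt.comp (h₂ := b) m.1 hdb (hasDerivAt_dx hV hφ hm)).mul
        (hasDerivAt_dx hV hψ hm)).add
        (HasDerivAt.comp (h₂ := c) m.1 hdc (hasDerivAt_dx hV hφ hm))).deriv
      refine hx.trans ?_
      simp only [Function.comp_apply, Prod.mk.eta]
      ring
    · have hy := (((HasDerivAt.comp (h₂ := b) m.2 hdb (hasDerivAt_dy hV hφ hm)).mul
        (hasDerivAt_dy hV hψ hm)).add
        (HasDerivAt.comp (h₂ := c) m.2 hdc (hasDerivAt_dy hV hφ hm))).deriv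
      refine hy.trans ?_
      simp only [Function.comp_apply, Prod.mk.eta]
      ring
    · rw [dx_comp hV hφ hm hζm]; ring
    · rw [dy_comp hV hφ hm hζm]; ring

end PointLin

/-! ### The main theorem -/

theorem mainTheorem2 (D : Set (ℝ × ℝ × ℝ)) (hD : IsOpen D) (f : ℝ × ℝ × ℝ → ℝ)
    (hf : ContDiffOn ℝ ∞ f D) (m₀ : ℝ × ℝ) (hm₀ : ∃ j ∈ D, PointLin.base j = m₀) :
    (PointLin.LinearizableAt D f m₀ ↔
      ∃ (U : Set (ℝ × ℝ)) (F₃ F₂ F₁ F w z : ℝ × ℝ → ℝ),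
        IsOpen U ∧ m₀ ∈ U ∧ PointLin.Criterion D f U F₃ F₂ F₁ F w z) ∧
    (∀ (U : Set (ℝ × ℝ)) (F₃ F₂ F₁ F w z : ℝ × ℝ → ℝ),
      IsOpen U → m₀ ∈ U → PointLin.Criterion D f U F₃ F₂ F₁ F w z →
        (∃ (V : Set (ℝ × ℝ)) (φ ψ : ℝ × ℝ → ℝ),
          IsOpen V ∧ m₀ ∈ V ∧ V ⊆ U ∧
          PointLin.SolvesSystem V F₃ F₂ F₁ F w z φ ∧
          PointLin.SolvesSystem V F₃ F₂ F₁ F w z ψ ∧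
          ∀ m ∈ V, PointLin.jacobian φ ψ m ≠ 0) ∧
        (∀ (V : Set (ℝ × ℝ)) (φ ψ : ℝ × ℝ → ℝ),
          IsOpen V → V ⊆ U →
          PointLin.SolvesSystem V F₃ F₂ F₁ F w z φ →
          PointLin.SolvesSystem V F₃ F₂ F₁ F w z ψ →
          (∀ m ∈ V, PointLin.jacobian φ ψ m ≠ 0) →
          PointLin.TransformsTo D f V φ ψ (fun _ => 0) (fun _ => 0) (fun _ => 0))) := by
  have hsol : ∀ (U : Set (ℝ × ℝ)) (F₃ F₂ F₁ F w z : ℝ × ℝ → ℝ),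
      IsOpen U → m₀ ∈ U → PointLin.Criterion D f U F₃ F₂ F₁ F w z →
        ∃ (V : Set (ℝ × ℝ)) (φ ψ : ℝ × ℝ → ℝ),
          IsOpen V ∧ m₀ ∈ V ∧ V ⊆ U ∧
          PointLin.SolvesSystem V F₃ F₂ F₁ F w z φ ∧
          PointLin.SolvesSystem V F₃ F₂ F₁ F w z ψ ∧
          ∀ m ∈ V, PointLin.jacobian φ ψ m ≠ 0 := by
    intro U F₃ F₂ F₁ F w z hU hm₀U hC
    obtain ⟨⟨x, y, p⟩, hj, rfl⟩ := hm₀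
    -- Flatness is known only below jets of D, so U is cut down to the points over which the fixed
    -- slope p is admissible; this contains m₀ by `hm₀`.
    have hN : IsOpen ((fun m : ℝ × ℝ => (m.1, m.2, p)) ⁻¹' D) :=
      hD.preimage (by fun_prop)
    have hsub : U ∩ (fun m : ℝ × ℝ => (m.1, m.2, p)) ⁻¹' D ⊆ U := inter_subset_left
    obtain ⟨V, φ, ψ, hV, hmV, hVU, hφ, hψ, hJ⟩ := PointLin.exists_independent_solutions
      (hU.inter hN) (hC.smooth_F₃.mono hsub) (hC.smooth_F₂.mono hsub) (hC.smooth_F₁.mono hsub)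
      (hC.smooth_F.mono hsub) (hC.smooth_w.mono hsub) (hC.smooth_z.mono hsub)
      (fun m hm => hC.isFlatAt hD hf hU (j := (m.1, m.2, p)) hm.2 hm.1) ⟨hm₀U, hj⟩
    exact ⟨V, φ, ψ, hV, hmV, hVU.trans hsub, hφ, hψ, hJ⟩
  have htr : ∀ (U : Set (ℝ × ℝ)) (F₃ F₂ F₁ F w z : ℝ × ℝ → ℝ),
      PointLin.Criterion D f U F₃ F₂ F₁ F w z → ∀ (V : Set (ℝ × ℝ)) (φ ψ : ℝ × ℝ → ℝ),
          IsOpen V → V ⊆ U →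
          PointLin.SolvesSystem V F₃ F₂ F₁ F w z φ →
          PointLin.SolvesSystem V F₃ F₂ F₁ F w z ψ →
          (∀ m ∈ V, PointLin.jacobian φ ψ m ≠ 0) →
          PointLin.TransformsTo D f V φ ψ (fun _ => 0) (fun _ => 0) (fun _ => 0) :=
    fun U F₃ F₂ F₁ F w z hC V φ ψ hV hVU hφ hψ hJ =>
      PointLin.transformsTo_of_solvesSystem hV (fun j hj hjV => hC.cubic j hj (hVU hjV)) hφ hψ hJ
  refine ⟨⟨fun h => h.exists_criterion hD hf, ?_⟩, fun U F₃ F₂ F₁ F w z hU hm₀U hC =>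
    ⟨hsol U F₃ F₂ F₁ F w z hU hm₀U hC, htr U F₃ F₂ F₁ F w z hC⟩⟩
  rintro ⟨U, F₃, F₂, F₁, F, w, z, hU, hm₀U, hC⟩
  obtain ⟨V, φ, ψ, hV, hmV, hVU, hφ, hψ, hJ⟩ := hsol U F₃ F₂ F₁ F w z hU hm₀U hC
  -- The free particle equation is the linear equation with a = b = c = 0, smooth on the whole line.
  exact ⟨V, φ, ψ, univ, _, _, _, hV, hmV, ⟨hφ.smooth, hψ.smooth, hJ⟩, isOpen_univ,
    mapsTo_univ _ _, contDiffOn_const, contDiffOn_const, contDiffOn_const,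
    htr U F₃ F₂ F₁ F w z hC V φ ψ hV hVU hφ hψ hJ⟩
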